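/- Let $N\ge 2$ be an integer, $p\in(1,\infty)$ and $s\in(0,1)$. In the weak form below write $t^{p-1}:=|t|^{p-2}t$ for $t\in\mathbb R$ (with $0^{p-1}=0$); also, $t_+:=\max\{t,0\}$, $e_N=(0,\dots,0,1)\in\mathbb R^N$, and $B_r(x)$ for the open ball, $B_1=B_1(0)$. For $V\subseteq\mathbb R^N$ open, $W^{s,p}(V)$ is the space of $u\in L^p(V)$ with $\iint_{V\times V}\frac{|u(x)-u(y)|^p}{|x-y|^{N+ps}}\,dx\,dy<\infty$. For a bounded open $U$, $W^{s,p}_0(U)$ is the space of $\varphi\in W^{s,p}(\mathbb R^N)$ with $\varphi=0$ a.e. in $U^c$, and $\widetilde W^{s,p}(U)$ is the space of $u\in L^p_{\rm loc}(\mathbb R^N)$ such that $u\in W^{s,p}(V)$ for some open $V\supset\overline U$ and $\int_{\mathbb R^N}\frac{|u(x)|^{p-1}}{(1+|x|)^{N+ps}}\,dx<\infty$. For $a\in\mathbb R$, we say that $(-\Delta)^s_p u\ge a$ weakly in $U$ if $u\in\widetilde W^{s,p}(U)$ and, for all $\varphi\in W^{s,p}_0(U)$ with $\varphi\ge 0$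 a.e., the following left-hand integral converges absolutely and $$\iint_{\mathbb R^N\times\mathbb R^N}\frac{(u(x)-u(y))^{p-1}(\varphi(x)-\varphi(y))}{|x-y|^{N+ps}}\,dx\,dy\ \ge\ a\int_U\varphi\,dx .$$ **Lemma.** There exist a function $w:\mathbb R^N\to\mathbb R$ that is globally $s$-Hölder continuous (i.e. $|w(x)-w(y)|\le C|x-y|^s$ for some $C\ge 0$ and all $x,y\in\mathbb R^N$), and numbers $r>0$, $a\in(0,1)$, $c>1$, such that $$(-\Delta)^s_p w\ge a\quad\text{weakly in } B_r(e_N)\setminus\overline{B_1},$$ $$c^{-1}(|x|-1)_+^s\le w(x)\le c\,(|x|-1)_+^s\quad\text{for all } x\in\mathbb R^N .$$ -/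

import Mathlib

open MeasureTheory Set
open scoped NNReal ENNReal

namespace FracPLap

/-- The signed power `a ^ (p - 1) = |a| ^ (p - 2) * a` (equal to `0` at `a = 0`). -/
noncomputable def signedPow (p a : ℝ) : ℝ := |a| ^ (p - 2) * a

/-- The `p`-th power of the Gagliardo seminorm of `u` on `U`, as an extended real. -/
noncomputable def gagliardo {N : ℕ} (s p : ℝ) (U : Set (EuclideanSpace ℝ (Fin N)))
    (u : EuclideanSpace ℝ (Fin N) → ℝ) : ℝ≥0∞ :=
  ∫⁻ z in U ×ˢ U, ENNReal.ofReal (|u z.1 - u z.2| ^ p / ‖z.1 - z.2‖ ^ ((N : ℝ) + p * s))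
    ∂(volume.prod volume)

/-- `u ∈ W^{s,p}(U)`. -/
def MemW {N : ℕ} (s p : ℝ) (U : Set (EuclideanSpace ℝ (Fin N)))
    (u : EuclideanSpace ℝ (Fin N) → ℝ) : Prop :=
  MemLp u (ENNReal.ofReal p) (volume.restrict U) ∧ gagliardo s p U u < ∞

/-- `φ ∈ W₀^{s,p}(U)`: `φ ∈ W^{s,p}(ℝ^N)` and `φ = 0` a.e. outside `U`. -/
def MemW0 {N : ℕ} (s p : ℝ) (U : Set (EuclideanSpace ℝ (Fin N)))
    (φ : EuclideanSpace ℝ (Fin N) → ℝ) : Prop :=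
  MemW s p univ φ ∧ ∀ᵐ x, x ∉ U → φ x = 0

/-- The space `W̃^{s,p}(U)`, for bounded `U`: functions in `L^p_loc(ℝ^N)` that belong to
`W^{s,p}(V)` for some open `V` compactly containing `U`, with finite nonlocal tail. -/
def MemWTilde {N : ℕ} (s p : ℝ) (U : Set (EuclideanSpace ℝ (Fin N)))
    (u : EuclideanSpace ℝ (Fin N) → ℝ) : Prop :=
  (∀ K : Set (EuclideanSpace ℝ (Fin N)), IsCompact K →
      MemLp u (ENNReal.ofReal p) (volume.restrict K)) ∧
  (∃ V : Set (EuclideanSpace ℝ (Fin N)), IsOpen V ∧ IsCompact (closure U) ∧ closure U ⊆ V ∧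
      MemW s p V u) ∧
  Integrable (fun x : EuclideanSpace ℝ (Fin N) =>
    |u x| ^ (p - 1) / (1 + ‖x‖) ^ ((N : ℝ) + p * s)) volume

/-- The integrand, on `ℝ^N × ℝ^N`, of the weak form of `(-Δ)_p^s u` tested against `φ`. -/
noncomputable def weakIntegrand {N : ℕ} (s p : ℝ) (u φ : EuclideanSpace ℝ (Fin N) → ℝ)
    (z : EuclideanSpace ℝ (Fin N) × EuclideanSpace ℝ (Fin N)) : ℝ :=
  signedPow p (u z.1 - u z.2) * (φ z.1 - φ z.2) / ‖z.1 - z.2‖ ^ ((N : ℝ) + p * s)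

/-- `(-Δ)_p^s u ≥ a` weakly in the bounded open set `U`, for a constant `a`. -/
def WeaklyGe {N : ℕ} (s p : ℝ) (U : Set (EuclideanSpace ℝ (Fin N)))
    (u : EuclideanSpace ℝ (Fin N) → ℝ) (a : ℝ) : Prop :=
  MemWTilde s p U u ∧
  ∀ φ : EuclideanSpace ℝ (Fin N) → ℝ, MemW0 s p U φ → (∀ᵐ x, 0 ≤ φ x) →
    Integrable (weakIntegrand s p u φ) (volume.prod volume) ∧
    a * ∫ x in U, φ x ≤ ∫ z, weakIntegrand s p u φ z ∂(volume.prod volume)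

end FracPLap

namespace FracPLap

/-! ### Signed powers. -/

section SignedPow

variable {p : ℝ}

/-! On the half line, `t_+^s` is annihilated by the one-dimensional operator. A function of the
vertical height over a smooth graph sees that operator up to a term of lower order, caused by
curvature. The barrier is `height_+^s` near the pole and is made much smaller farther away; lowering
the function elsewhere makes the operator strictly positive, by enough to absorb the curvature.

In detail, `barrierBase` equals the height over the spherical cap at exterior points within `r` of
the pole, never exceeds the positive part of the height within `1/4`, and is only `r` times the
distance to the ball beyond `3r`. For `x` in the domain, `chart` preserves volume and turns the
kernel into `(|z|^2 + (t + q(z))^2)^(-β/2)` with `β = N + ps` and `q` 1-Lipschitz. Replacing `q` by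
its linear part costs one order (`abs_kernel_sub_le`, `abs_cap_taylor_le`); then `z` integrates out
and leaves `|t|^(-1-ps)` times a factor bounded below uniformly in the slope
(`integral_mul_kernel_ge`, `le_marginal`). In the variable `t`, the whole integral is nonnegative
(`setIntegral_incr_nonneg`), and discarding `|t| ≥ ρ` gains a multiple of `ρ^(-s)`
(`setIntegral_incr_far_le`). Curvature costs `O(ρ^(1-s))`, and the values of the barrier at distance
at least `ρ/2` cost `O(θ^(s(p-1)) ρ^(-s))` when `r = θρ` (`flux_barrier_ge`). Taking `ρ` small, then
`θ` small, gives `exists_integral_flux_ge`.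

The principal value is replaced by truncation to pairs whose heights are not within a factor `q` of
each other. This set is invariant under dilation of heights, so the one-dimensional integral is
explicit, and it is symmetric in the two points, so the truncated weak form is twice the pointwise
operator tested against `φ`. Fubini is justified by the Hardy-type bound
`integrable_test_mul_height`. Since the weak integrand is absolutely integrable
(`integrable_weakIntegrand`), dominated convergence as `q → 1` concludes in `weaklyGe_barrier`. -/

lemma abs_signedPow (hp : 1 < p) (a : ℝ) : |signedPow p a| = |a| ^ (p - 1) := by
  rcases eq_or_ne a 0 with rfl | ha
  · simp [signedPow, Real.zero_rpow (by linarith : p - 1 ≠ 0)]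
  · have h : 0 < |a| := abs_pos.2 ha
    rw [signedPow, abs_mul, abs_of_nonneg (Real.rpow_nonneg h.le _)]
    nth_rewrite 2 [← Real.rpow_one |a|]
    rw [← Real.rpow_add h]
    congr 1; ring

lemma signedPow_nonneg {a : ℝ} (ha : 0 ≤ a) : 0 ≤ signedPow p a :=
  mul_nonneg (Real.rpow_nonneg (abs_nonneg _) _) ha

lemma signedPow_of_nonneg (hp : 1 < p) {a : ℝ} (ha : 0 ≤ a) : signedPow p a = a ^ (p - 1) := by
  rw [← abs_of_nonneg (signedPow_nonneg ha), abs_signedPow hp, abs_of_nonneg ha]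

lemma signedPow_neg (a : ℝ) : signedPow p (-a) = -signedPow p a := by
  simp [signedPow]

lemma signedPow_of_nonpos (hp : 1 < p) {a : ℝ} (ha : a ≤ 0) :
    signedPow p a = -(-a) ^ (p - 1) := by
  rw [← signedPow_of_nonneg hp (neg_nonneg.2 ha), signedPow_neg, neg_neg]

lemma signedPow_mono (hp : 1 < p) : Monotone (signedPow p) := by
  intro a b hab
  have hp' : 0 ≤ p - 1 := by linarith
  rcases le_total 0 a with ha | ha
  · rw [signedPow_of_nonneg hp ha, signedPow_of_nonneg hp (ha.trans hab)]
    exact Real.rpow_le_rpow ha hab hp'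
  · rcases le_total 0 b with hb | hb
    · rw [signedPow_of_nonpos hp ha]
      exact le_trans (neg_nonpos.2 (Real.rpow_nonneg (neg_nonneg.2 ha) _)) (signedPow_nonneg hb)
    · rw [signedPow_of_nonpos hp ha, signedPow_of_nonpos hp hb]
      exact neg_le_neg (Real.rpow_le_rpow (neg_nonneg.2 hb) (neg_le_neg hab) hp')

lemma signedPow_mul (hp : 1 < p) {c : ℝ} (hc : 0 ≤ c) (a : ℝ) :
    signedPow p (c * a) = c ^ (p - 1) * signedPow p a := by
  rcases le_total 0 a with ha | ha
  · rw [signedPow_of_nonneg hp ha, signedPow_of_nonneg hp (mul_nonneg hc ha), Real.mul_rpow hc ha]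
  · rw [signedPow_of_nonpos hp ha, signedPow_of_nonpos hp (mul_nonpos_of_nonneg_of_nonpos hc ha),
      ← mul_neg, Real.mul_rpow hc (neg_nonneg.2 ha), mul_neg]

@[fun_prop]
lemma measurable_signedPow : Measurable (signedPow p) := by
  unfold signedPow; fun_prop

/-- Replacing one nonnegative number by another in `(a - b)^(p-1)` costs at most
`a^(p-1) + b^(p-1)`. -/
lemma signedPow_sub_ge (hp : 1 < p) {a b b' : ℝ} (ha : 0 ≤ a) (hb : 0 ≤ b) (hb' : 0 ≤ b') :
    signedPow p (a - b') - a ^ (p - 1) - b ^ (p - 1) ≤ signedPow p (a - b) := by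
  have h1 : signedPow p (a - b') ≤ a ^ (p - 1) := by
    rw [← signedPow_of_nonneg hp ha]; exact signedPow_mono hp (by linarith)
  have h2 : -b ^ (p - 1) ≤ signedPow p (a - b) := by
    rw [← signedPow_of_nonneg hp hb, ← signedPow_neg]; exact signedPow_mono hp (by linarith)
  linarith

end SignedPow

/-! ### Hölder and weighted Lipschitz bounds for real powers. -/

section Rpow

variable {s : ℝ}

lemma abs_rpow_sub_rpow_le (hs0 : 0 < s) (hs1 : s ≤ 1) {a b : ℝ} (ha : 0 ≤ a) (hb : 0 ≤ b) :
    |a ^ s - b ^ s| ≤ |a - b| ^ s := by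
  wlog h : b ≤ a generalizing a b
  · rw [abs_sub_comm, abs_sub_comm a b]; exact this hb ha (le_of_not_ge h)
  rw [abs_of_nonneg (sub_nonneg.2 (Real.rpow_le_rpow hb h hs0.le)), abs_of_nonneg (sub_nonneg.2 h)]
  have := Real.rpow_add_le_add_rpow (sub_nonneg.2 h) hb hs0.le hs1
  rw [sub_add_cancel] at this
  linarith

/-- Write `b^s = b * b^(s-1)` and use `a^(s-1) ≤ b^(s-1)`. Only the larger argument enters the
weight, so the smaller one may vanish. -/
lemma abs_rpow_sub_rpow_le_mul (hs0 : 0 < s) (hs1 : s ≤ 1) {a b : ℝ} (ha : 0 ≤ a) (hb : 0 ≤ b)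
    (hab : b ≤ a) : |a ^ s - b ^ s| ≤ |a - b| * a ^ (s - 1) := by
  rw [abs_of_nonneg (sub_nonneg.2 (Real.rpow_le_rpow hb hab hs0.le)),
    abs_of_nonneg (sub_nonneg.2 hab)]
  rcases eq_or_lt_of_le ha with rfl | ha'
  · have : b = 0 := le_antisymm hab hb
    simp [this]
  rcases eq_or_lt_of_le hb with rfl | hb'
  · rw [Real.zero_rpow hs0.ne', Real.rpow_sub_one ha'.ne']
    field_simp; simp
  have h1 : a ^ s = a * a ^ (s - 1) := by rw [Real.rpow_sub_one ha'.ne']; field_simp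
  have h2 : b ^ s = b * b ^ (s - 1) := by rw [Real.rpow_sub_one hb'.ne']; field_simp
  have h3 : a ^ (s - 1) ≤ b ^ (s - 1) := Real.rpow_le_rpow_of_nonpos hb' hab (by linarith)
  rw [h1, h2]
  nlinarith

end Rpow

/-! ### The one-dimensional profile. -/

variable {s p : ℝ}

/-- The increment `(τ^s - (τ + t)_+^s)^(p-1)` of the one-dimensional profile `t ↦ t_+^s`. -/
noncomputable def incr (s p τ t : ℝ) : ℝ := signedPow p (τ ^ s - (max (τ + t) 0) ^ s)

/-- The increments `t` for which `τ + t` is not within the factor `q` of `τ`. -/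
def farSet (q τ : ℝ) : Set ℝ := {t | τ + t ≤ q * τ ∨ τ ≤ q * (τ + t)}

lemma measurableSet_farSet (q τ : ℝ) : MeasurableSet (farSet q τ) := by
  have h1 : MeasurableSet {t : ℝ | τ + t ≤ q * τ} := measurableSet_le (by fun_prop) (by fun_prop)
  have h2 : MeasurableSet {t : ℝ | τ ≤ q * (τ + t)} := measurableSet_le (by fun_prop) (by fun_prop)
  exact h1.union h2

@[fun_prop]
lemma measurable_incr (τ : ℝ) : Measurable (incr s p τ) := by
  unfold incr; fun_prop

lemma abs_incr_le (hs0 : 0 < s) (hs1 : s ≤ 1) (hp : 1 < p) {τ : ℝ} (hτ : 0 ≤ τ) (t : ℝ) :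
    |incr s p τ t| ≤ |t| ^ (s * (p - 1)) := by
  rw [incr, abs_signedPow hp, Real.rpow_mul (abs_nonneg t)]
  refine Real.rpow_le_rpow (abs_nonneg _) ?_ (by linarith)
  refine (abs_rpow_sub_rpow_le hs0 hs1 hτ (le_max_right _ _)).trans ?_
  refine Real.rpow_le_rpow (abs_nonneg _) ?_ hs0.le
  rcases max_cases (τ + t) 0 with ⟨h, _⟩ | ⟨h, h'⟩
  · rw [h]; simp
  · rw [h, sub_zero, abs_of_nonneg hτ, abs_of_nonpos (by linarith)]; linarith

lemma integrableOn_abs_rpow {a c : ℝ} (ha : a < -1) (hc : 0 < c) :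
    IntegrableOn (fun t : ℝ => |t| ^ a) {t | c ≤ |t|} := by
  have h : {t : ℝ | c ≤ |t|} = Ici c ∪ Iic (-c) := by
    ext t; simp only [mem_ofPred_eq, le_abs, mem_union, mem_Ici, mem_Iic]
    constructor <;> rintro (h | h) <;> [left; right; left; right] <;> linarith
  have h1 : IntegrableOn (fun t : ℝ => |t| ^ a) (Ici c) := by
    rw [integrableOn_Ici_iff_integrableOn_Ioi]
    refine (integrableOn_Ioi_rpow_of_lt ha hc).congr_fun (fun t ht => ?_) measurableSet_Ioi
    simp only [abs_of_pos (hc.trans ht)]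
  rw [h]
  refine h1.union ?_
  have := (integrable_indicator_iff measurableSet_Ici).2 h1
  have h2 := this.comp_neg
  rw [← integrable_indicator_iff measurableSet_Iic]
  refine h2.congr (Filter.Eventually.of_forall fun t => ?_)
  simp only [indicator, mem_Ici, mem_Iic, abs_neg, le_neg]

lemma le_abs_of_mem_farSet {q τ t : ℝ} (hq0 : 0 < q) (hq1 : q < 1) (hτ : 0 < τ)
    (ht : t ∈ farSet q τ) : (1 - q) * τ ≤ |t| := by
  rcases ht with h | h
  · rw [le_abs]; right; linarith
  · rw [le_abs]; left
    have : τ * (1 - q) ≤ q * t := by linarith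
    have ht : 0 < t := by
      by_contra h'
      nlinarith [mul_pos hτ (sub_pos.2 hq1)]
    nlinarith

lemma integrableOn_incr (hs0 : 0 < s) (hs1 : s ≤ 1) (hp : 1 < p) {τ c : ℝ} (hτ : 0 ≤ τ)
    (hc : 0 < c) :
    IntegrableOn (fun t => incr s p τ t * |t| ^ (-1 - p * s)) {t | c ≤ |t|} := by
  have hm : MeasurableSet {t : ℝ | c ≤ |t|} := measurableSet_le (by fun_prop) (by fun_prop)
  refine Integrable.mono' (integrableOn_abs_rpow (a := -1 - s) (by linarith) hc)
    (by fun_prop) ?_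
  filter_upwards [ae_restrict_mem hm] with t ht
  have ht : 0 < |t| := lt_of_lt_of_le hc ht
  rw [Real.norm_eq_abs, abs_mul, abs_of_nonneg (Real.rpow_nonneg (abs_nonneg t) _)]
  refine (mul_le_mul_of_nonneg_right (abs_incr_le hs0 hs1 hp hτ t)
    (Real.rpow_nonneg (abs_nonneg t) _)).trans (le_of_eq ?_)
  rw [← Real.rpow_add ht]; congr 1; ring

/-- An explicit primitive: once the part above the diagonal is reflected by `v ↦ 1/v`, the sum of
the two integrands on `(0, 1)` is exactly this derivative. -/
lemma hasDerivAt_profile (hs0 : 0 < s) (hp : 1 < p) {v : ℝ} (hv0 : 0 < v) (hv1 : v < 1) :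
    HasDerivAt (fun v : ℝ => (1 - v ^ s) ^ p * (1 - v) ^ (-(p * s)) / (p * s))
      ((1 - v ^ s) ^ (p - 1) * (1 - v) ^ (-1 - p * s) * (1 - v ^ (s - 1))) v := by
  have hvs : 0 < 1 - v ^ s := sub_pos.2 (Real.rpow_lt_one hv0.le hv1 hs0)
  have h1 : HasDerivAt (fun v : ℝ => (1 - v ^ s) ^ p)
      (-(s * v ^ (s - 1)) * p * (1 - v ^ s) ^ (p - 1)) v :=
    ((Real.hasDerivAt_rpow_const (p := s) (Or.inl hv0.ne')).const_sub 1).rpow_const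
      (Or.inl hvs.ne')
  have h2 : HasDerivAt (fun v : ℝ => (1 - v) ^ (-(p * s)))
      (-1 * (-(p * s)) * (1 - v) ^ (-(p * s) - 1)) v :=
    ((hasDerivAt_id' v).const_sub 1).rpow_const (Or.inl (by linarith))
  refine ((h1.mul h2).div_const (p * s)).congr_deriv ?_
  have e1 : (1 - v ^ s) ^ p = (1 - v ^ s) ^ (p - 1) * (1 - v ^ s) := by
    rw [Real.rpow_sub_one hvs.ne']; field_simp
  have e2 : (1 - v) ^ (-(p * s)) = (1 - v) ^ (-1 - p * s) * (1 - v) := by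
    rw [show -1 - p * s = -(p * s) - 1 by ring, Real.rpow_sub_one (by linarith)]
    have : 1 - v ≠ 0 := by linarith
    field_simp
  have e3 : v ^ s = v ^ (s - 1) * v := by rw [Real.rpow_sub_one hv0.ne']; field_simp
  have e4 : -(p * s) - 1 = -1 - p * s := by ring
  rw [e1, e2, e4]
  have hps : p * s ≠ 0 := by positivity
  have e5 : (1 - v ^ s) ^ (p - 1) * (1 - v) ^ (-1 - p * s) * (1 - v ^ (s - 1)) * (p * s) =
      (1 - v ^ s) ^ (p - 1) * (1 - v) ^ (-1 - p * s) * (1 - v ^ (s - 1)) * p * s := by ring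
  rw [div_eq_iff hps, e5]
  linear_combination (-(p * s * (1 - v ^ s) ^ (p - 1) * (1 - v) ^ (-1 - p * s))) * e3

/-- The reflection `v ↦ 1 / v` of the part above the diagonal. -/
lemma incr_inversion (hs0 : 0 < s) (hp : 1 < p) {v : ℝ} (hv0 : 0 < v) (hv1 : v < 1) :
    v⁻¹ ^ 2 * (incr s p 1 (v⁻¹ - 1) * |v⁻¹ - 1| ^ (-1 - p * s)) =
      -((1 - v ^ s) ^ (p - 1) * (1 - v) ^ (-1 - p * s) * v ^ (s - 1)) := by
  have hvs : 0 < 1 - v ^ s := sub_pos.2 (Real.rpow_lt_one hv0.le hv1 hs0)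
  have hvs0 : 0 < v ^ s := Real.rpow_pos_of_pos hv0 s
  have h1 : (1 : ℝ) ^ s - (max (1 + (v⁻¹ - 1)) 0) ^ s = -((v ^ s)⁻¹ * (1 - v ^ s)) := by
    rw [add_sub_cancel, max_eq_left (by positivity), Real.inv_rpow hv0.le, Real.one_rpow]
    field_simp; ring
  have h2 : |v⁻¹ - 1| = v⁻¹ * (1 - v) := by
    rw [abs_of_nonneg (sub_nonneg.2 (one_le_inv₀ hv0 |>.2 hv1.le))]; field_simp
  rw [incr, h1, signedPow_neg, signedPow_of_nonneg hp (by positivity), h2,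
    Real.mul_rpow (by positivity) hvs.le, Real.mul_rpow (by positivity) (by linarith)]
  have h3 : v⁻¹ ^ 2 * ((v ^ s)⁻¹ ^ (p - 1) * v⁻¹ ^ (-1 - p * s)) = v ^ (s - 1) := by
    rw [← Real.rpow_neg hv0.le, ← Real.rpow_mul hv0.le, ← Real.rpow_neg_one, ← Real.rpow_natCast,
      ← Real.rpow_mul hv0.le, ← Real.rpow_mul hv0.le, ← Real.rpow_add hv0, ← Real.rpow_add hv0]
    congr 1; push_cast; ring
  rw [← h3]; ring

lemma image_inversion {q : ℝ} (hq0 : 0 < q) :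
    (fun t : ℝ => (1 + t)⁻¹ - 1) '' Ioc (-1) (q - 1) = Ici (q⁻¹ - 1) := by
  ext y
  simp only [mem_image, mem_Ioc, mem_Ici]
  constructor
  · rintro ⟨t, ⟨h1, h2⟩, rfl⟩
    have := inv_anti₀ (show 0 < 1 + t by linarith) (show 1 + t ≤ q by linarith)
    linarith
  · intro h
    have hy : 0 < 1 + y := by have := inv_pos.2 hq0; linarith
    refine ⟨(1 + y)⁻¹ - 1, ⟨by have := inv_pos.2 hy; linarith, ?_⟩, by simp⟩
    have := inv_anti₀ (inv_pos.2 hq0) (show q⁻¹ ≤ 1 + y by linarith)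
    rw [inv_inv] at this; linarith

/-- With `v = 1 + t`, the far set is `v ≤ 0`, `0 < v ≤ q` and `v ≥ 1/q`, and inversion carries the
last piece onto the middle one. The integral then equals the primitive of `hasDerivAt_profile` at
`q`, which is nonnegative. -/
lemma setIntegral_incr_one_nonneg (hs0 : 0 < s) (hs1 : s ≤ 1) (hp : 1 < p) {q : ℝ} (hq0 : 0 < q)
    (hq1 : q < 1) :
    0 ≤ ∫ t in farSet q 1, incr s p 1 t * |t| ^ (-1 - p * s) := by
  have hps : 0 < p * s := by positivity
  set h : ℝ → ℝ := fun t => incr s p 1 t * |t| ^ (-1 - p * s) with hh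
  have hint : IntegrableOn h (farSet q 1) :=
    (integrableOn_incr hs0 hs1 hp zero_le_one (c := 1 - q) (by linarith)).mono_set fun t ht => by
      simpa using le_abs_of_mem_farSet hq0 hq1 one_pos ht
  have hset : farSet q 1 = Iic (-1) ∪ Ioc (-1) (q - 1) ∪ Ici (q⁻¹ - 1) := by
    ext t
    simp only [farSet, mem_ofPred_eq, mem_union, mem_Iic, mem_Ioc, mem_Ici]
    have e : 1 ≤ q * (1 + t) ↔ q⁻¹ - 1 ≤ t := by
      rw [← inv_le_iff_one_le_mul₀' hq0]; constructor <;> intro h <;> linarith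
    rw [e]
    constructor
    · rintro (h | h)
      · rcases le_or_gt t (-1) with h' | h'
        · exact Or.inl (Or.inl h')
        · exact Or.inl (Or.inr ⟨h', by linarith⟩)
      · exact Or.inr h
    · rintro ((h | h) | h)
      · left; linarith
      · left; linarith [h.2]
      · right; exact h
  have hqi : 1 < q⁻¹ := (one_lt_inv₀ hq0).2 hq1
  rw [hset] at hint ⊢
  have hi1 : IntegrableOn h (Iic (-1)) := hint.mono_set (by intro x hx; simp_all)
  have hi2 : IntegrableOn h (Ioc (-1) (q - 1)) := hint.mono_set (by intro x hx; simp_all)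
  have hi3 : IntegrableOn h (Ici (q⁻¹ - 1)) := hint.mono_set (by intro x hx; simp_all)
  rw [setIntegral_union _ measurableSet_Ici (hi1.union hi2) hi3,
    setIntegral_union _ measurableSet_Ioc hi1 hi2]
  rotate_left
  · rw [disjoint_left]; intro x hx hx'; simp only [mem_Iic, mem_Ioc] at hx hx'; linarith [hx'.1]
  · rw [disjoint_left]; intro x hx hx'
    simp only [mem_union, mem_Iic, mem_Ioc, mem_Ici] at hx hx'
    rcases hx with hx | hx <;> linarith
  -- The profile vanishes here, and the value is the primitive at `v = 0`; it cancels the lower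
  -- boundary term below.
  have I1 : ∫ t in Iic (-1 : ℝ), h t = 1 / (p * s) := by
    have : ∫ t in Iic (-1 : ℝ), h t = ∫ t in Iic (-1 : ℝ), (-t) ^ (-1 - p * s) := by
      refine setIntegral_congr_fun measurableSet_Iic fun t ht => ?_
      simp only [mem_Iic] at ht
      simp only [hh, incr]
      rw [max_eq_right (by linarith), Real.zero_rpow hs0.ne', abs_of_nonpos (by linarith),
        sub_zero, Real.one_rpow, signedPow_of_nonneg hp zero_le_one, Real.one_rpow, one_mul]
    rw [this, integral_comp_neg_Iic (-1) (fun t : ℝ => t ^ (-1 - p * s)), neg_neg,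
      integral_Ioi_rpow_of_lt (by linarith) one_pos, Real.one_rpow]
    rw [show -1 - p * s + 1 = -(p * s) by ring, neg_div_neg_eq]
  have hder : ∀ t ∈ Ioc (-1) (q - 1), HasDerivWithinAt (fun t : ℝ => (1 + t)⁻¹ - 1)
      (-1 / (1 + t) ^ 2) (Ioc (-1) (q - 1)) t := fun t ht =>
    (((hasDerivAt_id' t).const_add 1).fun_inv (by linarith [ht.1])).sub_const 1 |>.hasDerivWithinAt
  have hinj : InjOn (fun t : ℝ => (1 + t)⁻¹ - 1) (Ioc (-1) (q - 1)) := by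
    intro a _ b _ hab
    have := inv_injective (sub_left_injective hab)
    linarith
  set k : ℝ → ℝ := fun t => -((1 - (1 + t) ^ s) ^ (p - 1) * (1 - (1 + t)) ^ (-1 - p * s) *
    (1 + t) ^ (s - 1)) with hk
  have hcongr : ∀ t ∈ Ioc (-1) (q - 1),
      |-1 / (1 + t) ^ 2| • h ((1 + t)⁻¹ - 1) = k t := by
    intro t ht
    simp only [hk]
    rw [← incr_inversion hs0 hp (by linarith [ht.1]) (by linarith [ht.2]), abs_div, abs_neg,
      abs_one, abs_of_nonneg (by positivity), one_div, inv_pow, smul_eq_mul]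
  have I3 : ∫ t in Ici (q⁻¹ - 1), h t = ∫ t in Ioc (-1) (q - 1), k t := by
    rw [← image_inversion hq0, integral_image_eq_integral_abs_deriv_smul measurableSet_Ioc hder hinj]
    exact setIntegral_congr_fun measurableSet_Ioc hcongr
  have hik : IntegrableOn k (Ioc (-1) (q - 1)) := by
    rw [← image_inversion hq0,
      integrableOn_image_iff_integrableOn_abs_deriv_smul measurableSet_Ioc hder hinj] at hi3
    exact hi3.congr_fun hcongr measurableSet_Ioc
  have hle : (-1 : ℝ) ≤ q - 1 := by linarith
  rw [I1, I3, add_assoc, ← integral_add hi2 hik]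
  have hsum : ∀ t ∈ Ioc (-1) (q - 1), h t + k t = (1 - (1 + t) ^ s) ^ (p - 1) *
      (1 - (1 + t)) ^ (-1 - p * s) * (1 - (1 + t) ^ (s - 1)) := by
    intro t ht
    have h1 : (1 + t) ^ s ≤ 1 := Real.rpow_le_one (by linarith [ht.1]) (by linarith [ht.2]) hs0.le
    simp only [hh, hk, incr]
    rw [max_eq_left (by linarith [ht.1]), Real.one_rpow, signedPow_of_nonneg hp (by linarith),
      abs_of_nonpos (by linarith [ht.2]), show -t = 1 - (1 + t) by ring]
    ring
  have hig : IntegrableOn (fun t : ℝ => (1 - (1 + t) ^ s) ^ (p - 1) *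
      (1 - (1 + t)) ^ (-1 - p * s) * (1 - (1 + t) ^ (s - 1))) (Ioc (-1) (q - 1)) :=
    (hi2.add hik).congr_fun hsum measurableSet_Ioc
  rw [setIntegral_congr_fun measurableSet_Ioc hsum, ← intervalIntegral.integral_of_le hle]
  have hcont : ContinuousOn (fun t : ℝ => (1 - (1 + t) ^ s) ^ p * (1 - (1 + t)) ^ (-(p * s)) /
      (p * s)) (Icc (-1) (q - 1)) := by
    refine ContinuousOn.div_const (ContinuousOn.mul ?_ ?_) _
    · refine ContinuousOn.rpow_const (ContinuousOn.sub continuousOn_const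
        (ContinuousOn.rpow_const (by fun_prop) fun _ _ => Or.inr hs0.le)) fun _ _ => Or.inr ?_
      linarith
    · exact ContinuousOn.rpow_const (by fun_prop) fun t ht => Or.inl (by linarith [ht.2])
  rw [intervalIntegral.integral_eq_sub_of_hasDerivAt_of_le hle hcont
    (fun t ht => ?_) ((intervalIntegrable_iff_integrableOn_Ioc_of_le hle).2 hig)]
  · have h0 : 0 ≤ (1 - (1 + (q - 1)) ^ s) ^ p * (1 - (1 + (q - 1))) ^ (-(p * s)) / (p * s) := by
      rw [add_sub_cancel]
      have : q ^ s ≤ 1 := Real.rpow_le_one hq0.le hq1.le hs0.le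
      have h3 : 0 ≤ 1 - q ^ s := by linarith
      have h4 : 0 ≤ 1 - q := by linarith
      positivity
    simp only [add_neg_cancel, Real.zero_rpow hs0.ne', sub_zero, Real.one_rpow, mul_one]
    linarith
  · have := (hasDerivAt_profile hs0 hp (v := 1 + t) (by linarith [ht.1]) (by linarith [ht.2])).comp
      t ((hasDerivAt_id' t).const_add 1)
    rw [mul_one] at this
    exact this

/-- The truncated one-dimensional fractional `p`-Laplacian of `t_+^s` is nonnegative when the
excised neighbourhood of the diagonal is dilation invariant. -/
lemma setIntegral_incr_nonneg (hs0 : 0 < s) (hs1 : s ≤ 1) (hp : 1 < p) {q τ : ℝ} (hq0 : 0 < q)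
    (hq1 : q < 1) (hτ : 0 < τ) :
    0 ≤ ∫ t in farSet q τ, incr s p τ t * |t| ^ (-1 - p * s) := by
  rw [← integral_indicator (measurableSet_farSet q τ)]
  have h := Measure.integral_comp_mul_left ((farSet q τ).indicator
    fun t => incr s p τ t * |t| ^ (-1 - p * s)) τ
  -- Homogeneity of the profile and dilation invariance of the far set reduce everything to `τ = 1`.
  have h2 : ∀ u, (farSet q τ).indicator (fun t => incr s p τ t * |t| ^ (-1 - p * s)) (τ * u) =
      (τ ^ s) ^ (p - 1) * τ ^ (-1 - p * s) *
        (farSet q 1).indicator (fun t => incr s p 1 t * |t| ^ (-1 - p * s)) u := by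
    intro u
    have hmem : τ * u ∈ farSet q τ ↔ u ∈ farSet q 1 := by
      simp only [farSet, mem_ofPred_eq]
      rw [show τ + τ * u = τ * (1 + u) by ring, mul_comm q τ, mul_le_mul_iff_right₀ hτ,
        show q * (τ * (1 + u)) = τ * (q * (1 + u)) by ring, mul_one, le_mul_iff_one_le_right hτ]
    by_cases hu : u ∈ farSet q 1
    · rw [indicator_of_mem hu, indicator_of_mem (hmem.2 hu)]
      have e : τ ^ s - (max (τ + τ * u) 0) ^ s = τ ^ s * (1 ^ s - (max (1 + u) 0) ^ s) := by
        rw [show τ + τ * u = τ * (1 + u) by ring, ← mul_zero τ, ← mul_max_of_nonneg _ _ hτ.le,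
          mul_zero, Real.mul_rpow hτ.le (le_max_right _ _), Real.one_rpow]
        ring
      rw [incr, e, signedPow_mul hp (by positivity), abs_mul, abs_of_pos hτ,
        Real.mul_rpow hτ.le (abs_nonneg u), incr]
      ring
    · rw [indicator_of_notMem hu, indicator_of_notMem (mt hmem.1 hu), mul_zero]
  simp only [h2, integral_const_mul, integral_indicator (measurableSet_farSet q 1)] at h
  have h3 := setIntegral_incr_one_nonneg hs0 hs1 hp hq0 hq1
  have h4 : 0 < |τ⁻¹| := abs_pos.2 (inv_ne_zero hτ.ne')
  rw [smul_eq_mul] at h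
  exact nonneg_of_mul_nonneg_right (h ▸ mul_nonneg (by positivity) h3) h4

/-- Far from a point close to the boundary, the profile contributes a large negative amount. -/
lemma setIntegral_incr_far_le (hs0 : 0 < s) (hp : 1 < p) {θ ρ τ : ℝ} (hs1 : s ≤ 1)
    (hρ : 0 < ρ) (hθ0 : 0 ≤ θ) (hθ : θ ^ s ≤ 1 / 4) (hτ : 0 < τ) (hτθ : τ ≤ θ * ρ) :
    ∫ t in {t | ρ ≤ |t|}, incr s p τ t * |t| ^ (-1 - p * s) ≤
      -(((3 / 4) ^ (p - 1) - (1 / 4) ^ (p - 1)) / s * ρ ^ (-s)) := by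
  have hset : {t : ℝ | ρ ≤ |t|} = Iic (-ρ) ∪ Ici ρ := by
    ext t; simp only [mem_ofPred_eq, le_abs, mem_union, mem_Ici, mem_Iic]
    constructor <;> rintro (h | h) <;> [right; left; right; left] <;> linarith
  have hint := integrableOn_incr hs0 hs1 hp hτ.le hρ
  have hJ : ∫ t in Ioi ρ, t ^ (-1 - s) = ρ ^ (-s) / s := by
    rw [integral_Ioi_rpow_of_lt (by linarith) hρ, show -1 - s + 1 = -s by ring, neg_div_neg_eq]
  have hiJ : IntegrableOn (fun t : ℝ => t ^ (-1 - s)) (Ioi ρ) :=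
    integrableOn_Ioi_rpow_of_lt (by linarith) hρ
  have hpow : ∀ t : ℝ, 0 < t → (t ^ s) ^ (p - 1) * t ^ (-1 - p * s) = t ^ (-1 - s) := by
    intro t ht
    rw [← Real.rpow_mul ht.le, ← Real.rpow_add ht]; congr 1; ring
  have hτs : ∀ t : ℝ, ρ ≤ t → τ ^ s ≤ 1 / 4 * t ^ s := by
    intro t ht
    calc τ ^ s ≤ (θ * t) ^ s := Real.rpow_le_rpow hτ.le
          (hτθ.trans (mul_le_mul_of_nonneg_left ht hθ0)) hs0.le
      _ = θ ^ s * t ^ s := Real.mul_rpow hθ0 (hρ.le.trans ht)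
      _ ≤ _ := mul_le_mul_of_nonneg_right hθ (Real.rpow_nonneg (hρ.le.trans ht) _)
  rw [hset] at hint ⊢
  have hi1 := hint.mono_set subset_union_left
  have hi2 := hint.mono_set subset_union_right
  rw [setIntegral_union _ measurableSet_Ici hi1 hi2]
  swap
  · rw [disjoint_left]; intro x hx hx'; simp only [mem_Iic, mem_Ici] at hx hx'; linarith
  -- To the left the profile vanishes at `τ + t`, so the increment is only `τ^s ≤ |t|^s / 4`.
  have B1 : ∫ t in Iic (-ρ), incr s p τ t * |t| ^ (-1 - p * s) ≤
      (1 / 4) ^ (p - 1) * (ρ ^ (-s) / s) := by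
    rw [← hJ, ← integral_const_mul]
    have e := integral_comp_neg_Iic (-ρ) (fun t : ℝ => (1 / 4 : ℝ) ^ (p - 1) * t ^ (-1 - s))
    rw [neg_neg] at e
    rw [← e]
    refine setIntegral_mono_on hi1 ?_ measurableSet_Iic fun t ht => ?_
    · have := ((integrable_indicator_iff measurableSet_Ioi).2
        (hiJ.const_mul ((1 / 4 : ℝ) ^ (p - 1)))).comp_neg
      rw [integrableOn_Iic_iff_integrableOn_Iio, ← integrable_indicator_iff measurableSet_Iio]
      refine this.congr (Filter.Eventually.of_forall fun t => ?_)
      simp only [indicator, mem_Ioi, mem_Iio, lt_neg]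
    · have ht : ρ ≤ -t := le_neg.1 ht
      have htθ : τ ≤ -t := by
        by_contra hc
        have h1 := hτs (-t) ht
        have h2 := Real.rpow_le_rpow (hρ.le.trans ht) (not_le.1 hc).le hs0.le
        have h3 := Real.rpow_pos_of_pos hτ s
        linarith
      rw [abs_of_nonpos (by linarith), ← hpow (-t) (by linarith), ← mul_assoc,
        ← Real.mul_rpow (by norm_num) (Real.rpow_nonneg (by linarith) _), incr,
        max_eq_right (by linarith), Real.zero_rpow hs0.ne', sub_zero,
        signedPow_of_nonneg hp (Real.rpow_nonneg hτ.le _)]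
      exact mul_le_mul_of_nonneg_right (Real.rpow_le_rpow (Real.rpow_nonneg hτ.le _) (hτs _ ht)
        (by linarith)) (Real.rpow_nonneg (by linarith) _)
  -- To the right the increment is at most `t^s / 4 - t^s`, which outweighs the left side.
  have B2 : ∫ t in Ici ρ, incr s p τ t * |t| ^ (-1 - p * s) ≤
      -(3 / 4) ^ (p - 1) * (ρ ^ (-s) / s) := by
    rw [← hJ, ← integral_const_mul, integral_Ici_eq_integral_Ioi]
    refine setIntegral_mono_on (hi2.mono_set Ioi_subset_Ici_self) (hiJ.const_mul _)
      measurableSet_Ioi fun t ht => ?_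
    have ht : ρ < t := ht
    have ht0 : 0 < t := hρ.trans ht
    have h1 : t ^ s ≤ (τ + t) ^ s := Real.rpow_le_rpow ht0.le (by linarith) hs0.le
    rw [abs_of_pos ht0, ← hpow t ht0, ← mul_assoc]
    refine mul_le_mul_of_nonneg_right ?_ (Real.rpow_nonneg ht0.le _)
    rw [neg_mul, ← Real.mul_rpow (by norm_num) (Real.rpow_nonneg ht0.le _),
      ← signedPow_of_nonneg hp (mul_nonneg (by norm_num) (Real.rpow_nonneg ht0.le _)),
      ← signedPow_neg, incr, max_eq_left (by linarith)]
    refine signedPow_mono hp ?_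
    have := hτs t ht.le
    linarith
  refine (add_le_add B1 B2).trans (le_of_eq ?_)
  field_simp
  ring

/-! ### Comparison of kernels along nearby curves. -/

section Pointwise

lemma sq_add_sq_le {z t q : ℝ} (hq : |q| ≤ z) : (z ^ 2 + t ^ 2) / 3 ≤ z ^ 2 + (t + q) ^ 2 := by
  have h : q ^ 2 ≤ z ^ 2 := sq_le_sq' (by linarith [abs_le.1 hq]) (abs_le.1 hq).2
  nlinarith [sq_nonneg (2 * t + 3 * q)]

lemma sq_add_sq_ge {z t q : ℝ} (hq : |q| ≤ z) : z ^ 2 + (t + q) ^ 2 ≤ 3 * (z ^ 2 + t ^ 2) := by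
  have h : q ^ 2 ≤ z ^ 2 := sq_le_sq' (by linarith [abs_le.1 hq]) (abs_le.1 hq).2
  nlinarith [sq_nonneg (t - q)]

/-- Bernoulli's inequality for `(A/B)^h` replaces the mean value theorem. It asks for `h ≥ 1`; with
`h = (N + ps)/2` this holds because `N ≥ 2`. -/
lemma abs_rpow_neg_sub_le {A B X h : ℝ} (hX : 0 < X) (hA : X ≤ A) (hB : X ≤ B) (hh : 1 ≤ h) :
    |A ^ (-h) - B ^ (-h)| ≤ h * X ^ (-h - 1) * |A - B| := by
  wlog hAB : A ≤ B generalizing A B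
  · rw [abs_sub_comm, abs_sub_comm A B]; exact this hB hA (le_of_not_ge hAB)
  have hA0 : 0 < A := hX.trans_le hA
  have hB0 : 0 < B := hX.trans_le hB
  have h1 : B ^ (-h) ≤ A ^ (-h) := Real.rpow_le_rpow_of_nonpos hA0 hAB (by linarith)
  rw [abs_of_nonneg (sub_nonneg.2 h1), abs_sub_comm, abs_of_nonneg (sub_nonneg.2 hAB)]
  have hx : -1 ≤ A / B - 1 := by have := div_pos hA0 hB0; linarith
  have hb := one_add_mul_self_le_rpow_one_add hx hh
  rw [add_sub_cancel] at hb
  have e : B ^ (-h) = A ^ (-h) * (A / B) ^ h := by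
    rw [Real.div_rpow hA0.le hB0.le, Real.rpow_neg hA0.le, Real.rpow_neg hB0.le]
    have := (Real.rpow_pos_of_pos hA0 h).ne'
    field_simp
  have h2 : A ^ (-h) ≤ X ^ (-h) := Real.rpow_le_rpow_of_nonpos hX hA (by linarith)
  have h3 : 0 < X ^ (-h) := Real.rpow_pos_of_pos hX _
  have h4 : 0 < A ^ (-h) := Real.rpow_pos_of_pos hA0 _
  have h5 : (B - A) / B ≤ (B - A) / X := div_le_div_of_nonneg_left (sub_nonneg.2 hAB) hX hB
  have h6 : 1 - (A / B) ^ h ≤ h * ((B - A) / B) := by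
    have : (B - A) / B = 1 - A / B := by field_simp
    rw [this]; linarith
  have h7 : 0 ≤ (B - A) / X := div_nonneg (sub_nonneg.2 hAB) hX.le
  calc A ^ (-h) - B ^ (-h) = A ^ (-h) * (1 - (A / B) ^ h) := by rw [e]; ring
    _ ≤ A ^ (-h) * (h * ((B - A) / X)) :=
        mul_le_mul_of_nonneg_left (h6.trans (mul_le_mul_of_nonneg_left h5 (by linarith))) h4.le
    _ ≤ X ^ (-h) * (h * ((B - A) / X)) :=
        mul_le_mul_of_nonneg_right h2 (mul_nonneg (by linarith) h7)
    _ = h * X ^ (-h - 1) * (B - A) := by rw [Real.rpow_sub_one hX.ne']; ring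

/-- Two kernels along curves with the same tangent differ by one order less. -/
lemma abs_kernel_sub_le {z t q₁ q₂ κ M : ℝ} (hX : 0 < z ^ 2 + t ^ 2) (h1 : |q₁| ≤ z)
    (h2 : |q₂| ≤ z) (hM : 0 ≤ M) (h12 : |q₁ - q₂| ≤ M * z ^ 2) (hκ : 2 ≤ κ) :
    |(z ^ 2 + (t + q₁) ^ 2) ^ (-(κ / 2)) - (z ^ 2 + (t + q₂) ^ 2) ^ (-(κ / 2))| ≤
      κ / 2 * 3 ^ (κ / 2 + 1) * (4 * M) * (z ^ 2 + t ^ 2) ^ (-((κ - 1) / 2)) := by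
  set X := z ^ 2 + t ^ 2 with hXd
  have hz : 0 ≤ z := (abs_nonneg _).trans h1
  refine (abs_rpow_neg_sub_le (X := X / 3) (by positivity) (sq_add_sq_le h1) (sq_add_sq_le h2)
    (by linarith)).trans ?_
  have hs : 0 ≤ √X := Real.sqrt_nonneg _
  have hzX : z ≤ √X := Real.le_sqrt_of_sq_le (by nlinarith [sq_nonneg t])
  have htX : |t| ≤ √X := Real.abs_le_sqrt (by nlinarith [sq_nonneg z])
  have hd : |z ^ 2 + (t + q₁) ^ 2 - (z ^ 2 + (t + q₂) ^ 2)| ≤ 4 * M * (X * √X) := by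
    have e : z ^ 2 + (t + q₁) ^ 2 - (z ^ 2 + (t + q₂) ^ 2) = (q₁ - q₂) * (2 * t + q₁ + q₂) := by
      ring
    have h3 : |2 * t + q₁ + q₂| ≤ 4 * √X := by
      rw [abs_le] at h1 h2 htX ⊢
      constructor <;> linarith [h1.1, h1.2, h2.1, h2.2, htX.1, htX.2]
    have h4 : z ^ 2 ≤ X := by nlinarith [sq_nonneg t]
    rw [e, abs_mul]
    calc |q₁ - q₂| * |2 * t + q₁ + q₂| ≤ (M * X) * (4 * √X) :=
          mul_le_mul (h12.trans (mul_le_mul_of_nonneg_left h4 hM)) h3 (abs_nonneg _)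
            (by positivity)
      _ = _ := by ring
  have hpow : (X / 3) ^ (-(κ / 2) - 1) * (X * √X) =
      3 ^ (κ / 2 + 1) * X ^ (-((κ - 1) / 2)) := by
    have e1 : X * √X = X ^ (3 / 2 : ℝ) := by
      rw [Real.sqrt_eq_rpow, ← Real.rpow_one_add' hX.le (by norm_num)]; norm_num
    rw [e1, Real.div_rpow hX.le (by norm_num), div_eq_mul_inv, ← Real.rpow_neg (by norm_num),
      mul_right_comm, ← Real.rpow_add hX, mul_comm]
    congr 2 <;> ring
  calc κ / 2 * (X / 3) ^ (-(κ / 2) - 1) * |z ^ 2 + (t + q₁) ^ 2 - (z ^ 2 + (t + q₂) ^ 2)|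
      ≤ κ / 2 * (X / 3) ^ (-(κ / 2) - 1) * (4 * M * (X * √X)) :=
        mul_le_mul_of_nonneg_left hd (by positivity)
    _ = κ / 2 * (4 * M) * ((X / 3) ^ (-(κ / 2) - 1) * (X * √X)) := by ring
    _ = _ := by rw [hpow]; ring

end Pointwise

/-! ### Integrating out the tangential variables. -/

section Marginal

variable {n : ℕ}

local notation "F" => EuclideanSpace ℝ (Fin n)

/-- The value at height one of the marginal of the kernel frozen with slope `b`. -/
noncomputable def marginal (κ : ℝ) (b : EuclideanSpace ℝ (Fin n)) : ℝ :=
  ∫ z : EuclideanSpace ℝ (Fin n), (‖z‖ ^ 2 + (1 + inner ℝ b z) ^ 2) ^ (-(κ / 2))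

lemma kernel_scale {κ t : ℝ} (ht : t ≠ 0) (b z : F) :
    (‖t • z‖ ^ 2 + (t + inner ℝ b (t • z)) ^ 2) ^ (-(κ / 2)) =
      |t| ^ (-κ) * (‖z‖ ^ 2 + (1 + inner ℝ b z) ^ 2) ^ (-(κ / 2)) := by
  have ht' : 0 < |t| := abs_pos.2 ht
  have e : ‖t • z‖ ^ 2 + (t + inner ℝ b (t • z)) ^ 2 =
      |t| ^ 2 * (‖z‖ ^ 2 + (1 + inner ℝ b z) ^ 2) := by
    rw [norm_smul, inner_smul_right, Real.norm_eq_abs, mul_pow, sq_abs]; ring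
  rw [e, Real.mul_rpow (by positivity) (by positivity), ← Real.rpow_natCast |t| 2,
    ← Real.rpow_mul ht'.le]
  congr 2; push_cast; ring

/-- Substitute `z ↦ t • z`. For `κ = N + ps` and `n = N - 1` the power of `|t|` is the
one-dimensional kernel exponent `-1 - ps`. -/
lemma integral_kernel {κ t : ℝ} (ht : t ≠ 0) (b : F) :
    ∫ z : F, (‖z‖ ^ 2 + (t + inner ℝ b z) ^ 2) ^ (-(κ / 2)) =
      |t| ^ ((n : ℝ) - κ) * marginal κ b := by
  have ht' : 0 < |t| := abs_pos.2 ht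
  have h := Measure.integral_comp_smul (volume : Measure F)
    (fun z => (‖z‖ ^ 2 + (t + inner ℝ b z) ^ 2) ^ (-(κ / 2))) t
  simp only [kernel_scale ht, integral_const_mul, finrank_euclideanSpace, Fintype.card_fin] at h
  rw [smul_eq_mul, abs_inv, abs_pow, ← div_eq_inv_mul, eq_div_iff (by positivity)] at h
  rw [← h, marginal, sub_eq_add_neg, Real.rpow_add ht', Real.rpow_natCast]
  ring

lemma integrable_kernel_zero {κ t : ℝ} (hκ : (n : ℝ) < κ) (ht : t ≠ 0) :
    Integrable fun z : F => (‖z‖ ^ 2 + t ^ 2) ^ (-(κ / 2)) := by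
  have h1 : Integrable fun z : F => (1 + ‖z‖ ^ 2) ^ (-κ / 2) :=
    integrable_rpow_neg_one_add_norm_sq (by simpa using hκ)
  have h2 := (h1.comp_smul (inv_ne_zero ht)).const_mul (|t| ^ (-κ))
  refine h2.congr (Filter.Eventually.of_forall fun z => ?_)
  have := kernel_scale (κ := κ) ht 0 (t⁻¹ • z)
  simp only [smul_inv_smul₀ ht, inner_zero_left, add_zero] at this
  simp only [this]
  rw [one_pow, neg_div, add_comm]

lemma marginal_nonneg (κ : ℝ) (b : F) : 0 ≤ marginal κ b :=
  integral_nonneg fun _ => by positivity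

lemma kernel_le {κ t : ℝ} (hκ : 0 ≤ κ) (ht : t ≠ 0) {z : F} {q : ℝ} (hq : |q| ≤ ‖z‖) :
    (‖z‖ ^ 2 + (t + q) ^ 2) ^ (-(κ / 2)) ≤ 3 ^ (κ / 2) * (‖z‖ ^ 2 + t ^ 2) ^ (-(κ / 2)) := by
  have hX : 0 < ‖z‖ ^ 2 + t ^ 2 := by positivity
  refine (Real.rpow_le_rpow_of_nonpos (by positivity) (sq_add_sq_le (t := t) hq)
    (by linarith)).trans (le_of_eq ?_)
  rw [Real.div_rpow hX.le (by norm_num), div_eq_mul_inv, ← Real.rpow_neg (by norm_num), neg_neg,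
    mul_comm]

lemma le_kernel {κ t : ℝ} (hκ : 0 ≤ κ) (ht : t ≠ 0) {z : F} {q : ℝ} (hq : |q| ≤ ‖z‖) :
    3 ^ (-(κ / 2)) * (‖z‖ ^ 2 + t ^ 2) ^ (-(κ / 2)) ≤ (‖z‖ ^ 2 + (t + q) ^ 2) ^ (-(κ / 2)) := by
  have hX : 0 < ‖z‖ ^ 2 + t ^ 2 := by positivity
  rw [← Real.mul_rpow (by norm_num) hX.le]
  exact Real.rpow_le_rpow_of_nonpos (lt_of_lt_of_le (by positivity) (sq_add_sq_le (t := t) hq))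
    (sq_add_sq_ge hq) (by linarith)

lemma abs_inner_le_norm {b : F} (hb : ‖b‖ ≤ 1) (z : F) : |inner ℝ b z| ≤ ‖z‖ :=
  (abs_real_inner_le_norm b z).trans (mul_le_of_le_one_left (norm_nonneg z) hb)

lemma integrable_kernel {κ t : ℝ} (hκ : (n : ℝ) < κ) (ht : t ≠ 0) {q : F → ℝ}
    (hqm : Measurable q) (hq : ∀ z, |q z| ≤ ‖z‖) :
    Integrable fun z : F => (‖z‖ ^ 2 + (t + q z) ^ 2) ^ (-(κ / 2)) := by
  refine Integrable.mono' ((integrable_kernel_zero hκ ht).const_mul (3 ^ (κ / 2)))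
    (Measurable.aestronglyMeasurable (by fun_prop)) (Filter.Eventually.of_forall fun z => ?_)
  rw [Real.norm_eq_abs, abs_of_nonneg (by positivity)]
  exact kernel_le ((Nat.cast_nonneg n).trans hκ.le) ht (hq z)

lemma marginal_zero_pos {κ : ℝ} (hκ : (n : ℝ) < κ) : 0 < marginal κ (0 : F) := by
  have hi := integrable_kernel_zero (n := n) hκ one_ne_zero
  rw [marginal]
  simp only [inner_zero_left, add_zero]
  rw [integral_pos_iff_support_of_nonneg (fun z => by positivity) hi]
  have : Function.support (fun z : F => (‖z‖ ^ 2 + (1 : ℝ) ^ 2) ^ (-(κ / 2))) = univ := by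
    ext z; simp only [Function.mem_support, mem_univ, iff_true]; positivity
  rw [this]; exact Measure.measure_univ_pos.2 (NeZero.ne _)

/-- A tilt of slope at most one changes the kernel by a bounded factor, so the gain does not depend
on the base point. -/
lemma le_marginal {κ : ℝ} (hκ : (n : ℝ) < κ) {b : F} (hb : ‖b‖ ≤ 1) :
    3 ^ (-(κ / 2)) * marginal κ (0 : F) ≤ marginal κ b := by
  rw [marginal, marginal, ← integral_const_mul]
  have h0 : (0 : ℝ) ≤ κ := (Nat.cast_nonneg n).trans hκ.le
  refine integral_mono ?_ (integrable_kernel hκ one_ne_zero (by fun_prop) (abs_inner_le_norm hb))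
    fun z => ?_
  · simpa using (integrable_kernel_zero (n := n) hκ one_ne_zero).const_mul (3 ^ (-(κ / 2)))
  · simpa using le_kernel h0 one_ne_zero (abs_inner_le_norm hb z)

lemma ae_snd_ne_zero : ∀ᵐ x : F × ℝ ∂((volume : Measure F).prod volume), x.2 ≠ 0 := by
  have h : ∀ᵐ t : ℝ, t ≠ 0 := by simp [ae_iff]
  exact Measure.quasiMeasurePreserving_snd.ae h

lemma integrable_mul_kernel {κ : ℝ} (hκ : (n : ℝ) < κ) {a : ℝ → ℝ} (ham : Measurable a)
    (ha : Integrable fun t => a t * |t| ^ ((n : ℝ) - κ)) :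
    Integrable (fun x : F × ℝ => a x.2 * (‖x.1‖ ^ 2 + x.2 ^ 2) ^ (-(κ / 2)))
      ((volume : Measure F).prod volume) := by
  rw [integrable_prod_iff' (by fun_prop)]
  have hne : ∀ᵐ t : ℝ, t ≠ 0 := by simp [ae_iff]
  constructor
  · filter_upwards [hne] with t ht
    exact (integrable_kernel_zero hκ ht).const_mul _
  · refine (ha.norm.mul_const (marginal κ (0 : F))).congr ?_
    filter_upwards [hne] with t ht
    have := integral_kernel (κ := κ) ht (0 : F)
    simp only [inner_zero_left, add_zero] at this
    have e : ∀ z : F, ‖(‖z‖ ^ 2 + t ^ 2) ^ (-(κ / 2))‖ = (‖z‖ ^ 2 + t ^ 2) ^ (-(κ / 2)) := fun z =>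
      Real.norm_of_nonneg (by positivity)
    simp only [norm_mul, integral_const_mul, e, this]
    rw [Real.norm_of_nonneg (show 0 ≤ |t| ^ ((n : ℝ) - κ) by positivity), mul_assoc]

lemma integrable_mul_kernel' {κ : ℝ} (hκ : (n : ℝ) < κ) {a : ℝ → ℝ} (ham : Measurable a)
    (ha : Integrable fun t => a t * |t| ^ ((n : ℝ) - κ)) {q : F → ℝ}
    (hqm : Measurable q) (hq : ∀ z, |q z| ≤ ‖z‖) :
    Integrable (fun x : F × ℝ => a x.2 * (‖x.1‖ ^ 2 + (x.2 + q x.1) ^ 2) ^ (-(κ / 2)))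
      ((volume : Measure F).prod volume) := by
  refine Integrable.mono' ((integrable_mul_kernel hκ ham ha).norm.const_mul (3 ^ (κ / 2)))
    (by fun_prop) ?_
  have hne : ∀ᵐ x : F × ℝ ∂((volume : Measure F).prod volume), x.2 ≠ 0 :=
    ae_snd_ne_zero
  filter_upwards [hne] with x hx
  rw [norm_mul, norm_mul, Real.norm_of_nonneg
      (show 0 ≤ (‖x.1‖ ^ 2 + (x.2 + q x.1) ^ 2) ^ (-(κ / 2)) by positivity),
    Real.norm_of_nonneg (show 0 ≤ (‖x.1‖ ^ 2 + x.2 ^ 2) ^ (-(κ / 2)) by positivity), mul_left_comm]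
  exact mul_le_mul_of_nonneg_left (kernel_le ((Nat.cast_nonneg n).trans hκ.le) hx (hq _))
    (norm_nonneg _)

/-- Integrating a function of the last variable against the kernel along a graph: up to one order
less, the graph may be replaced by its tangent plane. -/
lemma integral_mul_kernel_ge {κ M : ℝ} (hκ : (n : ℝ) + 1 < κ) (hκ2 : 2 ≤ κ) (hM : 0 ≤ M)
    {a : ℝ → ℝ} (ham : Measurable a) (ha : Integrable fun t => a t * |t| ^ ((n : ℝ) - κ))
    (ha' : Integrable fun t => a t * |t| ^ ((n : ℝ) + 1 - κ))
    {q : F → ℝ} (hqm : Measurable q) (hq : ∀ z, |q z| ≤ ‖z‖) {b : F} (hb : ‖b‖ ≤ 1)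
    (hqb : ∀ z, |q z - inner ℝ b z| ≤ M * ‖z‖ ^ 2) :
    marginal κ b * (∫ t, a t * |t| ^ ((n : ℝ) - κ)) -
        κ / 2 * 3 ^ (κ / 2 + 1) * (4 * M) * marginal (κ - 1) (0 : F) *
          (∫ t, |a t| * |t| ^ ((n : ℝ) + 1 - κ)) ≤
      ∫ x : F × ℝ, a x.2 * (‖x.1‖ ^ 2 + (x.2 + q x.1) ^ 2) ^ (-(κ / 2))
        ∂((volume : Measure F).prod volume) := by
  have hκn : (n : ℝ) < κ := by linarith
  have hκn' : (n : ℝ) < κ - 1 := by linarith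
  have hne : ∀ᵐ t : ℝ, t ≠ 0 := by simp [ae_iff]
  have i1 := integrable_mul_kernel' hκn ham ha hqm hq
  have i2 := integrable_mul_kernel' hκn ham ha (q := fun z => inner ℝ b z) (by fun_prop)
    (abs_inner_le_norm hb)
  have ha'' : Integrable fun t => |a t| * |t| ^ ((n : ℝ) - (κ - 1)) := by
    refine ha'.norm.congr (Filter.Eventually.of_forall fun t => ?_)
    simp only [norm_mul, Real.norm_eq_abs]
    rw [abs_of_nonneg (show 0 ≤ |t| ^ ((n : ℝ) + 1 - κ) by positivity),
      show (n : ℝ) - (κ - 1) = n + 1 - κ by ring]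
  have i3 := (integrable_mul_kernel hκn' (a := fun t => |a t|) (by fun_prop) ha'').const_mul
    (κ / 2 * 3 ^ (κ / 2 + 1) * (4 * M))
  have e2 : ∫ x : F × ℝ, a x.2 * (‖x.1‖ ^ 2 + (x.2 + inner ℝ b x.1) ^ 2) ^ (-(κ / 2))
      ∂((volume : Measure F).prod volume) = marginal κ b * ∫ t, a t * |t| ^ ((n : ℝ) - κ) := by
    rw [integral_prod_symm _ i2, ← integral_const_mul]
    refine integral_congr_ae ?_
    filter_upwards [hne] with t ht
    simp only [integral_const_mul]
    rw [integral_kernel ht]; ring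
  have e3 : ∫ x : F × ℝ, κ / 2 * 3 ^ (κ / 2 + 1) * (4 * M) *
      (|a x.2| * (‖x.1‖ ^ 2 + x.2 ^ 2) ^ (-((κ - 1) / 2))) ∂((volume : Measure F).prod volume) =
      κ / 2 * 3 ^ (κ / 2 + 1) * (4 * M) * marginal (κ - 1) (0 : F) *
          (∫ t, |a t| * |t| ^ ((n : ℝ) + 1 - κ)) := by
    rw [integral_prod_symm _ i3, ← integral_const_mul]
    refine integral_congr_ae ?_
    filter_upwards [hne] with t ht
    have := integral_kernel (κ := κ - 1) ht (0 : F)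
    simp only [inner_zero_left, add_zero] at this
    simp only [integral_const_mul, this]
    rw [show (n : ℝ) - (κ - 1) = n + 1 - κ by ring]; ring
  rw [← e2, ← e3, ← integral_sub i2 i3]
  refine integral_mono_ae (i2.sub i3) i1 ?_
  have hne : ∀ᵐ x : F × ℝ ∂((volume : Measure F).prod volume), x.2 ≠ 0 :=
    ae_snd_ne_zero
  filter_upwards [hne] with x hx
  have hX : 0 < ‖x.1‖ ^ 2 + x.2 ^ 2 := by positivity
  have h := abs_kernel_sub_le hX (hq x.1) (abs_inner_le_norm hb x.1) hM (hqb x.1) hκ2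
  have h' := mul_le_mul_of_nonneg_left h (abs_nonneg (a x.2))
  rw [← abs_mul] at h'
  have := neg_le_of_abs_le h'
  linarith

end Marginal

/-! ### The sphere as a graph near the north pole. -/

section Graph

variable {F : Type*} [NormedAddCommGroup F]

/-- The graph of the unit sphere near the north pole, extended to a Lipschitz function. -/
noncomputable def cap (a : F) : ℝ := √(max (1 - ‖a‖ ^ 2) (1 / 2))

/-- The truncated radius `u` and the value of `cap` lie on the unit circle with `u` at most `cap`,
an arc of slope at most one. The constant 1 is what the bounds on the kernel require. -/
lemma abs_cap_sub_le (a b : F) : |cap a - cap b| ≤ ‖a - b‖ := by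
  have key : ∀ c : F, ∃ u, u = min ‖c‖ (√(1 / 2)) ∧ 0 ≤ u ∧ u ≤ cap c ∧ cap c ^ 2 + u ^ 2 = 1 := by
    intro c
    have h2 : √(1 / 2 : ℝ) ^ 2 = 1 / 2 := Real.sq_sqrt (by norm_num)
    have hs := Real.sqrt_nonneg (1 / 2 : ℝ)
    have hsq : cap c ^ 2 = max (1 - ‖c‖ ^ 2) (1 / 2) :=
      Real.sq_sqrt (le_max_of_le_right (by norm_num))
    have hu : (min ‖c‖ (√(1 / 2))) ^ 2 + max (1 - ‖c‖ ^ 2) (1 / 2) = 1 := by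
      rcases le_total ‖c‖ (√(1 / 2)) with h | h
      · have : ‖c‖ ^ 2 ≤ 1 / 2 := by nlinarith [norm_nonneg c]
        rw [min_eq_left h, max_eq_left (by linarith)]; ring
      · have : 1 / 2 ≤ ‖c‖ ^ 2 := by nlinarith
        rw [min_eq_right h, max_eq_right (by linarith), h2]; norm_num
    have hu0 : 0 ≤ min ‖c‖ (√(1 / 2)) := le_min (norm_nonneg c) hs
    refine ⟨_, rfl, hu0, ?_, by rw [hsq]; linarith⟩
    have h3 : min ‖c‖ (√(1 / 2)) ≤ √(1 / 2) := min_le_right _ _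
    exact h3.trans (Real.sqrt_le_sqrt (le_max_right _ _))
  obtain ⟨u, hu, hu0, hua, hu1⟩ := key a
  obtain ⟨v, hv, hv0, hvb, hv1⟩ := key b
  have hpos : 0 < cap a + cap b := by
    have : 0 < cap a := Real.sqrt_pos.2 (lt_max_of_lt_right (by norm_num))
    have : 0 < cap b := Real.sqrt_pos.2 (lt_max_of_lt_right (by norm_num))
    positivity
  have h1 : |cap a - cap b| * (cap a + cap b) = |v - u| * (v + u) := by
    have e : (cap a - cap b) * (cap a + cap b) = (v - u) * (v + u) := by nlinarith
    have e' := congrArg abs e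
    rwa [abs_mul, abs_mul, abs_of_pos hpos, abs_of_nonneg (add_nonneg hv0 hu0)] at e'
  have h2 : |cap a - cap b| ≤ |v - u| := by
    by_contra h
    push Not at h
    nlinarith [abs_nonneg (v - u)]
  refine h2.trans ?_
  rw [hu, hv, abs_sub_comm]
  refine (abs_min_sub_min_le_max _ _ _ _).trans ?_
  rw [sub_self, abs_zero, max_eq_left (abs_nonneg _)]
  exact abs_norm_sub_norm_le a b

lemma cap_sq_of_le {a : F} (ha : ‖a‖ ^ 2 ≤ 1 / 2) : cap a ^ 2 = 1 - ‖a‖ ^ 2 := by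
  rw [cap, Real.sq_sqrt (le_max_of_le_right (by norm_num)), max_eq_left (by linarith)]

lemma cap_pos (a : F) : 0 < cap a := Real.sqrt_pos.2 (lt_max_of_lt_right (by norm_num))

lemma cap_ge {a : F} (ha : ‖a‖ ≤ 1 / 4) : 1 / 2 ≤ cap a := by
  have h := cap_sq_of_le (a := a) (by nlinarith [norm_nonneg a])
  nlinarith [cap_pos a, norm_nonneg a]

lemma continuous_cap : Continuous (cap : F → ℝ) := by unfold cap; fun_prop

variable [InnerProductSpace ℝ F]

/-- The gradient of `cap`. -/
noncomputable def capGrad (a : F) : F := -((cap a)⁻¹ • a)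

lemma norm_capGrad_le {a : F} (ha : ‖a‖ ≤ 1 / 4) : ‖capGrad a‖ ≤ 1 := by
  have h := cap_ge ha
  rw [capGrad, norm_neg, norm_smul, norm_inv, Real.norm_of_nonneg (by linarith),
    ← div_eq_inv_mul, div_le_one (by linarith)]
  linarith

/-- Where `cap` follows the sphere, subtracting the two equations `cap^2 + ‖·‖^2 = 1` gives the
remainder exactly. Elsewhere `‖z‖` is bounded below and a linear bound is already quadratic. -/
lemma abs_cap_taylor_le {a : F} (ha : ‖a‖ ≤ 1 / 4) (z : F) :
    |cap (a + z) - cap a - inner ℝ (capGrad a) z| ≤ 5 * ‖z‖ ^ 2 := by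
  have hz := norm_nonneg z
  have hL := abs_cap_sub_le (a + z) a
  rw [add_sub_cancel_left] at hL
  rcases le_or_gt (‖a + z‖ ^ 2) (1 / 2) with h | h
  · have hγ := cap_ge ha
    have hA := cap_sq_of_le h
    have hB := cap_sq_of_le (a := a) (by nlinarith [norm_nonneg a])
    rw [norm_add_sq_real] at hA
    have hi : inner ℝ (capGrad a) z = -(inner ℝ a z / cap a) := by
      rw [capGrad, inner_neg_left, real_inner_smul_left, div_eq_inv_mul]
    have hne : cap a ≠ 0 := by linarith
    have e : cap (a + z) - cap a - inner ℝ (capGrad a) z =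
        -((‖z‖ ^ 2 + (cap (a + z) - cap a) ^ 2) / (2 * cap a)) := by
      rw [hi]; field_simp; nlinarith
    have h2 : (cap (a + z) - cap a) ^ 2 ≤ ‖z‖ ^ 2 := sq_le_sq' (abs_le.1 hL).1 (abs_le.1 hL).2
    rw [e, abs_neg, abs_of_nonneg (by positivity), div_le_iff₀ (by linarith)]
    nlinarith [sq_nonneg ‖z‖]
  · have hin := abs_real_inner_le_norm (capGrad a) z
    have hn := norm_capGrad_le ha
    -- Hence `‖z‖ ≥ 7/10 - 1/4 = 9/20`, and `2‖z‖ ≤ 5‖z‖^2`.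
    have h7 : 7 / 10 ≤ ‖a + z‖ := by nlinarith [norm_nonneg (a + z)]
    have h8 := norm_add_le a z
    calc |cap (a + z) - cap a - inner ℝ (capGrad a) z|
        ≤ |cap (a + z) - cap a| + |inner ℝ (capGrad a) z| := abs_sub _ _
      _ ≤ ‖z‖ + 1 * ‖z‖ := add_le_add hL (hin.trans (mul_le_mul_of_nonneg_right hn hz))
      _ ≤ 5 * ‖z‖ ^ 2 := by nlinarith

end Graph

/-! ### Splitting off the last coordinate and flattening the graph. -/

section Coordinates

variable {n : ℕ}

local notation "F" => EuclideanSpace ℝ (Fin n)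
local notation "E" => EuclideanSpace ℝ (Fin (n + 1))

/-- The first `n` coordinates. -/
noncomputable def horiz (x : EuclideanSpace ℝ (Fin (n + 1))) : EuclideanSpace ℝ (Fin n) :=
  WithLp.toLp 2 fun i => x (Fin.castSucc i)

/-- The last coordinate. -/
def vert (x : EuclideanSpace ℝ (Fin (n + 1))) : ℝ := x (Fin.last n)

/-- The point with given first coordinates and last coordinate. -/
noncomputable def joinCoord (a : EuclideanSpace ℝ (Fin n)) (t : ℝ) :
    EuclideanSpace ℝ (Fin (n + 1)) :=
  WithLp.toLp 2 (Fin.snoc (α := fun _ => ℝ) a t)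

@[simp] lemma horiz_joinCoord (a : F) (t : ℝ) : horiz (joinCoord a t) = a := by
  ext i; simp [horiz, joinCoord]

@[simp] lemma vert_joinCoord (a : F) (t : ℝ) : vert (joinCoord a t) = t := by
  simp [vert, joinCoord]

lemma horiz_sub (x y : E) : horiz (x - y) = horiz x - horiz y := by ext i; simp [horiz]

lemma vert_sub (x y : E) : vert (x - y) = vert x - vert y := by simp [vert]

lemma norm_sq_eq_horiz_vert (x : E) : ‖x‖ ^ 2 = ‖horiz x‖ ^ 2 + vert x ^ 2 := by
  rw [EuclideanSpace.norm_sq_eq, EuclideanSpace.norm_sq_eq, Fin.sum_univ_castSucc]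
  simp [horiz, vert]

lemma norm_horiz_le (x : E) : ‖horiz x‖ ≤ ‖x‖ := by
  have := norm_sq_eq_horiz_vert x
  exact le_of_sq_le_sq (by nlinarith [sq_nonneg (vert x)]) (norm_nonneg x)

lemma abs_vert_le (x : E) : |vert x| ≤ ‖x‖ := by
  have := norm_sq_eq_horiz_vert x
  exact abs_le_of_sq_le_sq (by nlinarith [sq_nonneg ‖horiz x‖]) (norm_nonneg x)

@[fun_prop]
lemma continuous_horiz : Continuous (horiz : E → F) := by unfold horiz; fun_prop

@[fun_prop]
lemma continuous_vert : Continuous (vert : E → ℝ) := by unfold vert; fun_prop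

lemma measurePreserving_joinCoord :
    MeasurePreserving (fun x : F × ℝ => joinCoord x.1 x.2)
      ((volume : Measure F).prod volume) volume := by
  have h1 : MeasurePreserving (Prod.map (id : ℝ → ℝ) (WithLp.ofLp : F → Fin n → ℝ))
      ((volume : Measure ℝ).prod (volume : Measure F)) (volume.prod volume) :=
    (MeasurePreserving.id volume).prod (PiLp.volume_preserving_ofLp (Fin n))
  have h2 := (volume_preserving_piFinSuccAbove (fun _ : Fin (n + 1) => ℝ) (Fin.last n)).symm
  have h3 := (PiLp.volume_preserving_toLp (Fin (n + 1))).comp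
    (h2.comp (h1.comp (Measure.measurePreserving_swap (μ := (volume : Measure F))
      (ν := (volume : Measure ℝ)))))
  have e : (fun x : F × ℝ => joinCoord x.1 x.2) = WithLp.toLp 2 ∘
      (MeasurableEquiv.piFinSuccAbove (fun _ : Fin (n + 1) => ℝ) (Fin.last n)).symm ∘
        Prod.map (id : ℝ → ℝ) (WithLp.ofLp : F → Fin n → ℝ) ∘ Prod.swap := by
    funext x
    refine congrArg (WithLp.toLp 2) ?_
    exact (Fin.insertNth_last' x.2 x.1.ofLp).symm
  rw [e]
  exact h3

/-- The height above the graph of `cap`. -/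
noncomputable def height (x : EuclideanSpace ℝ (Fin (n + 1))) : ℝ := vert x - cap (horiz x)

@[fun_prop]
lemma continuous_height : Continuous (height : E → ℝ) :=
  continuous_vert.sub (continuous_cap.comp continuous_horiz)

lemma abs_height_sub_le (x y : E) : |height x - height y| ≤ 2 * ‖x - y‖ := by
  have h1 := abs_vert_le (x - y)
  have h2 := (abs_cap_sub_le (horiz x) (horiz y)).trans
    ((horiz_sub x y) ▸ norm_horiz_le (x - y))
  rw [vert_sub] at h1
  have e : height x - height y = (vert x - vert y) - (cap (horiz x) - cap (horiz y)) := by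
    simp only [height]; ring
  rw [e]
  exact (abs_sub _ _).trans (by linarith)

/-- Coordinates centered at `x` straightening the graph of `cap`. -/
noncomputable def chart (x : EuclideanSpace ℝ (Fin (n + 1)))
    (w : EuclideanSpace ℝ (Fin n) × ℝ) : EuclideanSpace ℝ (Fin (n + 1)) :=
  joinCoord (horiz x + w.1) (height x + w.2 + cap (horiz x + w.1))

/-- A shear: a translation in the horizontal variable followed by a translation along each vertical
fibre. Measuring height vertically, instead of by distance, is what keeps the Jacobian equal to one.
-/
lemma measurePreserving_chart (x : E) :
    MeasurePreserving (chart x) ((volume : Measure F).prod volume) volume := by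
  have h := (measurePreserving_add_left (volume : Measure F) (horiz x)).skew_product
    (μc := (volume : Measure ℝ)) (μd := (volume : Measure ℝ))
    (g := fun z t => height x + t + cap (horiz x + z)) (by
      have := (continuous_cap : Continuous (cap : F → ℝ)).measurable
      unfold Function.uncurry; fun_prop)
    (Filter.Eventually.of_forall fun z => by
      have := (measurePreserving_add_right (volume : Measure ℝ) (height x + cap (horiz x + z)))
      convert this.map_eq using 2
      ext t; ring)
  exact measurePreserving_joinCoord.comp h

lemma height_chart (x : E) (w : F × ℝ) : height (chart x w) = height x + w.2 := by
  simp [height, chart]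

lemma norm_sub_chart_sq (x : E) (w : F × ℝ) :
    ‖x - chart x w‖ ^ 2 =
      ‖w.1‖ ^ 2 + (w.2 + (cap (horiz x + w.1) - cap (horiz x))) ^ 2 := by
  rw [norm_sq_eq_horiz_vert, horiz_sub, vert_sub]
  simp only [chart, horiz_joinCoord, vert_joinCoord, height]
  rw [sub_add_cancel_left, norm_neg]
  ring

end Coordinates

/-! ### The base function of the barrier. -/

section Barrier

variable {n : ℕ}

local notation "E" => EuclideanSpace ℝ (Fin (n + 1))

/-- The north pole. -/
noncomputable def pole (n : ℕ) : EuclideanSpace ℝ (Fin (n + 1)) :=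
  EuclideanSpace.single (Fin.last n) 1

@[simp] lemma horiz_pole : horiz (pole n) = 0 := by
  ext i; simp [horiz, pole]

@[simp] lemma vert_pole : vert (pole n) = 1 := by simp [vert, pole]

@[simp] lemma norm_pole : ‖pole n‖ = 1 := by simp [pole]

lemma height_pole : height (pole n) = 0 := by
  have : max (1 : ℝ) 2⁻¹ = 1 := max_eq_left (by norm_num)
  simp [height, cap, this]

/-- The distance to the unit ball. -/
noncomputable def extDist (x : EuclideanSpace ℝ (Fin (n + 1))) : ℝ := max (‖x‖ - 1) 0

lemma extDist_nonneg (x : E) : 0 ≤ extDist x := le_max_right _ _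

lemma abs_extDist_sub_le (x y : E) : |extDist x - extDist y| ≤ ‖x - y‖ := by
  refine (abs_max_sub_max_le_abs _ _ _).trans ?_
  rw [sub_sub_sub_cancel_right]
  exact abs_norm_sub_norm_le x y

lemma norm_horiz_le_of_near {y : E} (hy : ‖y - pole n‖ < 1 / 4) : ‖horiz y‖ ≤ 1 / 4 := by
  have := norm_horiz_le (y - pole n)
  rw [horiz_sub, horiz_pole, sub_zero] at this
  linarith

/-- Both sides are `‖y‖^2 - 1`. Comparing the second factors makes height and distance to the ball
comparable near the pole. -/
lemma height_identity {y : E} (hy : ‖y - pole n‖ < 1 / 4) :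
    height y * (vert y + cap (horiz y)) = (‖y‖ - 1) * (‖y‖ + 1) := by
  have h := norm_horiz_le_of_near hy
  have h1 := cap_sq_of_le (a := horiz y) (by nlinarith [norm_nonneg (horiz y)])
  have h2 := norm_sq_eq_horiz_vert y
  rw [height]; nlinarith

lemma near_bounds {y : E} (hy : ‖y - pole n‖ < 1 / 4) :
    3 / 4 ≤ vert y ∧ 1 / 2 ≤ cap (horiz y) ∧ cap (horiz y) ≤ 1 ∧ vert y ≤ ‖y‖ ∧ ‖y‖ ≤ 5 / 4 := by
  have h := norm_horiz_le_of_near hy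
  have h1 := abs_vert_le (y - pole n)
  rw [vert_sub, vert_pole] at h1
  have h2 := norm_le_norm_add_norm_sub' y (pole n)
  rw [norm_pole] at h2
  have h3 := cap_sq_of_le (a := horiz y) (by nlinarith [norm_nonneg (horiz y)])
  refine ⟨by linarith [abs_le.1 h1], cap_ge h, ?_, (le_abs_self _).trans (abs_vert_le y),
    by linarith⟩
  nlinarith [cap_pos (horiz y), sq_nonneg ‖horiz y‖]

lemma extDist_le_height {y : E} (hy : ‖y - pole n‖ < 1 / 4) :
    extDist y ≤ max (height y) 0 := by
  obtain ⟨h1, h2, h3, h4, h5⟩ := near_bounds hy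
  have h := height_identity hy
  refine max_le ?_ (le_max_right _ _)
  rcases le_or_gt ‖y‖ 1 with h6 | h6
  · exact (sub_nonpos.2 h6).trans (le_max_right _ _)
  · refine le_max_of_le_left ?_
    have hs : 0 < vert y + cap (horiz y) := by linarith
    refine le_of_mul_le_mul_right ?_ hs
    rw [h]
    exact mul_le_mul_of_nonneg_left (by linarith) (by linarith)

lemma height_le_extDist {y : E} (hy : ‖y - pole n‖ < 1 / 4) : height y ≤ 2 * extDist y := by
  obtain ⟨h1, h2, h3, h4, h5⟩ := near_bounds hy
  have h := height_identity hy
  have hd : ‖y‖ - 1 ≤ extDist y := le_max_left _ _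
  have hd0 := extDist_nonneg y
  have hs : 0 < vert y + cap (horiz y) := by linarith
  refine le_of_mul_le_mul_right ?_ hs
  rw [h]
  nlinarith [norm_nonneg y]

/-- The Lipschitz function whose power is the barrier. -/
noncomputable def barrierBase (r : ℝ) (x : EuclideanSpace ℝ (Fin (n + 1))) : ℝ :=
  max (r * extDist x) (min (height x) (3 * r - ‖x - pole n‖))

variable {r : ℝ}

lemma barrierBase_ge (x : E) : r * extDist x ≤ barrierBase r x := le_max_left _ _

lemma barrierBase_nonneg (hr : 0 ≤ r) (x : E) : 0 ≤ barrierBase r x :=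
  (mul_nonneg hr (extDist_nonneg x)).trans (barrierBase_ge x)

lemma abs_barrierBase_sub_le (hr0 : 0 ≤ r) (hr1 : r ≤ 1) (x y : E) :
    |barrierBase r x - barrierBase r y| ≤ 2 * ‖x - y‖ := by
  have h0 := norm_nonneg (x - y)
  refine (abs_max_sub_max_le_max _ _ _ _).trans (max_le ?_ ?_)
  · rw [← mul_sub, abs_mul, abs_of_nonneg hr0]
    have := mul_le_mul hr1 (abs_extDist_sub_le x y) (abs_nonneg _) zero_le_one
    linarith
  · refine (abs_min_sub_min_le_max _ _ _ _).trans (max_le (abs_height_sub_le x y) ?_)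
    rw [sub_sub_sub_cancel_left, abs_sub_comm]
    have := abs_norm_sub_norm_le (x - pole n) (y - pole n)
    rw [sub_sub_sub_cancel_right] at this
    linarith

lemma continuous_barrierBase : Continuous (barrierBase r : E → ℝ) := by
  unfold barrierBase extDist; fun_prop

lemma barrierBase_le_height (hr1 : r ≤ 1) {y : E} (hy : ‖y - pole n‖ < 1 / 4) :
    barrierBase r y ≤ max (height y) 0 := by
  refine max_le ?_ ((min_le_left _ _).trans (le_max_left _ _))
  exact (mul_le_of_le_one_left (extDist_nonneg y) hr1).trans (extDist_le_height hy)

lemma barrierBase_far (hr0 : 0 ≤ r) {y : E} (hy : 3 * r ≤ ‖y - pole n‖) :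
    barrierBase r y = r * extDist y := by
  refine max_eq_left ((min_le_right _ _).trans ?_)
  have := mul_nonneg hr0 (extDist_nonneg y)
  linarith

lemma barrierBase_le (hr0 : 0 ≤ r) (hr1 : r ≤ 1 / 16) (y : E) :
    barrierBase r y ≤ 2 * extDist y := by
  have hd := extDist_nonneg y
  rcases le_or_gt (3 * r) ‖y - pole n‖ with h | h
  · rw [barrierBase_far hr0 h]; nlinarith
  · exact max_le (by nlinarith) ((min_le_left _ _).trans (height_le_extDist (by linarith)))

lemma height_pos {y : E} (hr1 : r ≤ 1 / 16) (hy : ‖y - pole n‖ < r) (hy1 : 1 < ‖y‖) :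
    0 < height y := by
  have h := extDist_le_height (y := y) (by linarith)
  have h2 : 0 < extDist y := lt_max_of_lt_left (by linarith)
  by_contra hc
  rw [max_eq_right (not_lt.1 hc)] at h
  linarith

lemma height_le {y : E} (hy : ‖y - pole n‖ < r) : height y ≤ 2 * r := by
  have h := abs_height_sub_le y (pole n)
  rw [height_pole, sub_zero] at h
  linarith [le_abs_self (height y)]

/-- Within `r` of the pole the height is at most `2r`, below the cut-off `3r - ‖y - pole n‖`; this
dictates the constant 3. -/
lemma barrierBase_eq_height {y : E} (hr1 : r ≤ 1 / 16) (hy : ‖y - pole n‖ < r) (hy1 : 1 < ‖y‖) :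
    barrierBase r y = height y := by
  have hp := height_pos hr1 hy hy1
  have hl := height_le hy
  rw [barrierBase, min_eq_left (by linarith), max_eq_right]
  have h := extDist_le_height (y := y) (by linarith)
  rw [max_eq_left hp.le] at h
  have := extDist_nonneg y
  nlinarith

end Barrier

/-! ### Tails of the kernel. -/

section Tail

variable {E : Type*} [NormedAddCommGroup E]

/-- The kernel `‖z‖^(-m)` restricted to `‖z‖ ≥ ρ`. -/
noncomputable def tailKer (m ρ : ℝ) (z : E) : ℝ := {z : E | ρ ≤ ‖z‖}.indicator (fun z => ‖z‖ ^ (-m)) z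

lemma tailKer_nonneg (m ρ : ℝ) (z : E) : 0 ≤ tailKer m ρ z :=
  indicator_nonneg (fun _ _ => by positivity) z

variable [InnerProductSpace ℝ E]

lemma tailKer_scale {m ρ : ℝ} (hρ : 0 < ρ) (z : E) :
    tailKer m ρ z = ρ ^ (-m) * tailKer m 1 (ρ⁻¹ • z) := by
  have hn : ‖ρ⁻¹ • z‖ = ρ⁻¹ * ‖z‖ := by rw [norm_smul, norm_inv, Real.norm_of_nonneg hρ.le]
  have hiff : ρ ≤ ‖z‖ ↔ 1 ≤ ‖ρ⁻¹ • z‖ := by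
    rw [hn, ← div_eq_inv_mul, le_div_iff₀ hρ, one_mul]
  by_cases h : ρ ≤ ‖z‖
  · rw [tailKer, tailKer, indicator_of_mem (by exact h), indicator_of_mem (by exact hiff.1 h), hn,
      ← Real.mul_rpow hρ.le (by positivity), mul_inv_cancel_left₀ hρ.ne']
  · rw [tailKer, tailKer, indicator_of_notMem (by exact h),
      indicator_of_notMem (by exact mt hiff.2 h), mul_zero]

variable [FiniteDimensional ℝ E] [MeasurableSpace E] [BorelSpace E]

lemma integrable_tailKer_one {m : ℝ} (hm : (Module.finrank ℝ E : ℝ) < m) :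
    Integrable (tailKer m 1 : E → ℝ) := by
  have hm0 : 0 < m := lt_of_le_of_lt (Nat.cast_nonneg _) hm
  have h := (integrable_one_add_norm (μ := (volume : Measure E)) hm).const_mul (2 ^ m)
  have hs : MeasurableSet {z : E | 1 ≤ ‖z‖} := measurableSet_le (by fun_prop) (by fun_prop)
  refine h.mono' (Measurable.aestronglyMeasurable ?_) (Filter.Eventually.of_forall fun z => ?_)
  · exact Measurable.indicator (by fun_prop) hs
  · rw [Real.norm_of_nonneg (tailKer_nonneg _ _ _)]
    rcases lt_or_ge ‖z‖ 1 with hz | hz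
    · rw [tailKer, indicator_of_notMem (by exact not_le.2 hz)]
      positivity
    have : 0 < ‖z‖ := by linarith
    rw [tailKer, indicator_of_mem (by exact hz), Real.rpow_neg this.le, Real.rpow_neg (by positivity), ← div_eq_mul_inv, inv_eq_one_div,
      div_le_div_iff₀ (by positivity) (by positivity), one_mul, ← Real.mul_rpow (by norm_num) this.le]
    exact Real.rpow_le_rpow (by positivity) (by linarith) hm0.le

lemma integrable_tailKer {m ρ : ℝ} (hm : (Module.finrank ℝ E : ℝ) < m) (hρ : 0 < ρ) :
    Integrable (tailKer m ρ : E → ℝ) := by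
  refine (((integrable_tailKer_one (E := E) hm).comp_smul (inv_ne_zero hρ.ne')).const_mul
    (ρ ^ (-m))).congr (Filter.Eventually.of_forall fun z => (tailKer_scale hρ z).symm)

lemma integral_tailKer {m ρ : ℝ} (hρ : 0 < ρ) :
    ∫ z : E, tailKer m ρ z = ρ ^ ((Module.finrank ℝ E : ℝ) - m) * ∫ z : E, tailKer m 1 z := by
  simp only [tailKer_scale hρ, integral_const_mul]
  rw [Measure.integral_comp_smul, smul_eq_mul, inv_pow, inv_inv, abs_of_pos (by positivity),
    ← mul_assoc, sub_eq_add_neg, Real.rpow_add hρ, Real.rpow_natCast, mul_comm (ρ ^ (-m))]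

lemma integrable_tailKer_sub {m ρ : ℝ} (hm : (Module.finrank ℝ E : ℝ) < m) (hρ : 0 < ρ) (x : E) :
    Integrable fun y => tailKer m ρ (x - y) :=
  (integrable_tailKer hm hρ).comp_sub_left x

lemma integral_tailKer_sub {m ρ : ℝ} (hρ : 0 < ρ) (x : E) :
    ∫ y : E, tailKer m ρ (x - y) =
      ρ ^ ((Module.finrank ℝ E : ℝ) - m) * ∫ z : E, tailKer m 1 z := by
  rw [integral_sub_left_eq_self (fun y => tailKer m ρ y), integral_tailKer hρ]

end Tail

/-! ### The barrier, its flux and the truncation. -/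

section Barrier

variable {n : ℕ} {s p r : ℝ}

local notation "E" => EuclideanSpace ℝ (Fin (n + 1))

/-- The barrier. -/
noncomputable def barrier (s r : ℝ) (x : EuclideanSpace ℝ (Fin (n + 1))) : ℝ := barrierBase r x ^ s

lemma barrier_nonneg (hr : 0 ≤ r) (x : E) : 0 ≤ barrier s r x :=
  Real.rpow_nonneg (barrierBase_nonneg hr x) s

lemma continuous_barrier (hs0 : 0 < s) : Continuous (barrier s r : E → ℝ) :=
  continuous_barrierBase.rpow_const fun _ => Or.inr hs0.le

lemma abs_barrier_sub_le (hs0 : 0 < s) (hs1 : s ≤ 1) (hr0 : 0 ≤ r) (hr1 : r ≤ 1) (x y : E) :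
    |barrier s r x - barrier s r y| ≤ (2 * ‖x - y‖) ^ s :=
  (abs_rpow_sub_rpow_le hs0 hs1 (barrierBase_nonneg hr0 x) (barrierBase_nonneg hr0 y)).trans
    (Real.rpow_le_rpow (abs_nonneg _) (abs_barrierBase_sub_le hr0 hr1 x y) hs0.le)

/-- The kernel `(u(x) - u(y))^(p-1) / |x - y|^(N + ps)`. -/
noncomputable def flux {N : ℕ} (s p : ℝ) (u : EuclideanSpace ℝ (Fin N) → ℝ)
    (x y : EuclideanSpace ℝ (Fin N)) : ℝ :=
  signedPow p (u x - u y) / ‖x - y‖ ^ ((N : ℝ) + p * s)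

/-- Hölder continuity compensates `s(p-1)` of the kernel's `ps`. The remaining exponent `N + s` is
integrable at infinity but not on the diagonal, hence the truncation. -/
lemma abs_flux_barrier_le (hs0 : 0 < s) (hs1 : s ≤ 1) (hp : 1 < p) (hr0 : 0 ≤ r) (hr1 : r ≤ 1)
    {x y : E} (hxy : x ≠ y) :
    |flux s p (barrier s r) x y| ≤ 2 ^ (s * (p - 1)) * ‖x - y‖ ^ (-(((n + 1 : ℕ) : ℝ) + s)) := by
  have h0 : 0 < ‖x - y‖ := norm_pos_iff.2 (sub_ne_zero.2 hxy)
  rw [flux, abs_div, abs_signedPow hp,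
    abs_of_nonneg (show 0 ≤ ‖x - y‖ ^ (((n + 1 : ℕ) : ℝ) + p * s) by positivity), div_eq_mul_inv,
    ← Real.rpow_neg h0.le]
  have h1 : |barrier s r x - barrier s r y| ^ (p - 1) ≤
      2 ^ (s * (p - 1)) * ‖x - y‖ ^ (s * (p - 1)) := by
    rw [← Real.mul_rpow (by norm_num) h0.le, Real.rpow_mul (by positivity)]
    exact Real.rpow_le_rpow (abs_nonneg _) (abs_barrier_sub_le hs0 hs1 hr0 hr1 x y) (by linarith)
  refine (mul_le_mul_of_nonneg_right h1 (by positivity)).trans (le_of_eq ?_)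
  rw [mul_assoc, ← Real.rpow_add h0]
  congr 2; ring

/-- The pairs of points whose heights are not within a factor `q` of each other. -/
def heightFar (n : ℕ) (q : ℝ) :
    Set (EuclideanSpace ℝ (Fin (n + 1)) × EuclideanSpace ℝ (Fin (n + 1))) :=
  {z | height z.2 ≤ q * height z.1 ∨ height z.1 ≤ q * height z.2}

lemma measurableSet_heightFar (q : ℝ) : MeasurableSet (heightFar n q) := by
  have h1 : MeasurableSet {z : E × E | height z.2 ≤ q * height z.1} :=
    measurableSet_le (by fun_prop) (by fun_prop)
  have h2 : MeasurableSet {z : E × E | height z.1 ≤ q * height z.2} :=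
    measurableSet_le (by fun_prop) (by fun_prop)
  exact h1.union h2

lemma mem_heightFar_iff {q : ℝ} {x y : E} :
    (x, y) ∈ heightFar n q ↔ height y - height x ∈ farSet q (height x) := by
  simp [heightFar, farSet]

lemma le_norm_of_mem_heightFar {q : ℝ} (hq0 : 0 < q) (hq1 : q < 1) {x y : E} (hx : 0 < height x)
    (h : (x, y) ∈ heightFar n q) : (1 - q) * height x / 2 ≤ ‖x - y‖ := by
  have h1 := le_abs_of_mem_farSet hq0 hq1 hx (mem_heightFar_iff.1 h)
  have h2 := abs_height_sub_le x y
  rw [abs_sub_comm] at h2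
  linarith

lemma measurable_flux (hs0 : 0 < s) :
    Measurable fun z : E × E => flux s p (barrier s r) z.1 z.2 := by
  have := (continuous_barrier (n := n) (r := r) hs0).measurable
  unfold flux; fun_prop

lemma norm_indicator_flux_le (hs0 : 0 < s) (hs1 : s ≤ 1) (hp : 1 < p) (hr0 : 0 ≤ r) (hr1 : r ≤ 1)
    {q : ℝ} (hq0 : 0 < q) (hq1 : q < 1) {x : E} (hx : 0 < height x) (y : E) :
    ‖(heightFar n q).indicator (fun z => flux s p (barrier s r) z.1 z.2) (x, y)‖ ≤
      2 ^ (s * (p - 1)) *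
        tailKer (((n + 1 : ℕ) : ℝ) + s) ((1 - q) * height x / 2) (x - y) := by
  have hpos : 0 < (1 - q) * height x / 2 := by
    have : 0 < 1 - q := by linarith
    positivity
  by_cases h : (x, y) ∈ heightFar n q
  · have h' := le_norm_of_mem_heightFar hq0 hq1 hx h
    have hxy : x ≠ y := by
      rintro rfl; rw [sub_self, norm_zero] at h'; linarith
    rw [indicator_of_mem h, tailKer, indicator_of_mem (by exact h')]
    exact abs_flux_barrier_le hs0 hs1 hp hr0 hr1 hxy
  · rw [indicator_of_notMem h, norm_zero]
    exact mul_nonneg (by positivity) (tailKer_nonneg _ _ _)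

lemma finrank_lt (hs0 : 0 < s) : (Module.finrank ℝ E : ℝ) < ((n + 1 : ℕ) : ℝ) + s := by
  simp [hs0]

lemma integrable_indicator_flux (hs0 : 0 < s) (hs1 : s ≤ 1) (hp : 1 < p) (hr0 : 0 ≤ r)
    (hr1 : r ≤ 1) {q : ℝ} (hq0 : 0 < q) (hq1 : q < 1) {x : E} (hx : 0 < height x) :
    Integrable fun y : E =>
      (heightFar n q).indicator (fun z => flux s p (barrier s r) z.1 z.2) (x, y) := by
  have hpos : 0 < (1 - q) * height x / 2 := by
    have : 0 < 1 - q := by linarith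
    positivity
  refine Integrable.mono' ((integrable_tailKer_sub (finrank_lt hs0) hpos x).const_mul
    (2 ^ (s * (p - 1)))) (Measurable.aestronglyMeasurable ?_)
    (Filter.Eventually.of_forall fun y => norm_indicator_flux_le hs0 hs1 hp hr0 hr1 hq0 hq1 hx y)
  exact ((measurable_flux hs0).indicator (measurableSet_heightFar q)).comp measurable_prodMk_left

/-- The truncation keeps `y` at a distance from `x` proportional to the height of `x`, so the tail
scales like `height^(-s)`. The constant degenerates as `q → 1`, but serves only to apply Fubini at
fixed `q`. -/
lemma integral_norm_indicator_flux_le (hs0 : 0 < s) (hs1 : s ≤ 1) (hp : 1 < p) (hr0 : 0 ≤ r)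
    (hr1 : r ≤ 1) {q : ℝ} (hq0 : 0 < q) (hq1 : q < 1) {x : E} (hx : 0 < height x) :
    ∫ y : E, ‖(heightFar n q).indicator (fun z => flux s p (barrier s r) z.1 z.2) (x, y)‖ ≤
      2 ^ (s * (p - 1)) * (((1 - q) / 2) ^ (-s) *
        ∫ z : E, tailKer (((n + 1 : ℕ) : ℝ) + s) 1 z) * height x ^ (-s) := by
  have hq : 0 < (1 - q) / 2 := by linarith
  have hpos : 0 < (1 - q) * height x / 2 := by
    have : 0 < 1 - q := by linarith
    positivity
  refine (integral_mono (integrable_indicator_flux hs0 hs1 hp hr0 hr1 hq0 hq1 hx).norm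
    ((integrable_tailKer_sub (finrank_lt hs0) hpos x).const_mul _)
    (norm_indicator_flux_le hs0 hs1 hp hr0 hr1 hq0 hq1 hx)).trans (le_of_eq ?_)
  rw [integral_const_mul, integral_tailKer_sub hpos, finrank_euclideanSpace, Fintype.card_fin,
    show (((n + 1 : ℕ) : ℝ) - (((n + 1 : ℕ) : ℝ) + s)) = -s by ring,
    show (1 - q) * height x / 2 = (1 - q) / 2 * height x by ring, Real.mul_rpow hq.le hx.le]
  ring

/-- The increment restricted to the far set and to `|t| < ρ`. -/
noncomputable def nearIncr (s p q ρ τ : ℝ) : ℝ → ℝ :=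
  (farSet q τ ∩ {t | |t| < ρ}).indicator (incr s p τ)

lemma measurableSet_near (q ρ τ : ℝ) : MeasurableSet (farSet q τ ∩ {t | |t| < ρ}) :=
  (measurableSet_farSet q τ).inter (measurableSet_lt (by fun_prop) (by fun_prop))

lemma abs_nearIncr_le (hs0 : 0 < s) (hs1 : s ≤ 1) (hp : 1 < p) {q ρ τ : ℝ} (hτ : 0 ≤ τ) (t : ℝ) :
    |nearIncr s p q ρ τ t| ≤ {t : ℝ | |t| < ρ}.indicator (fun t => |t| ^ (s * (p - 1))) t := by
  by_cases h : t ∈ farSet q τ ∩ {t | |t| < ρ}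
  · rw [nearIncr, indicator_of_mem h, indicator_of_mem h.2]
    exact abs_incr_le hs0 hs1 hp hτ t
  · rw [nearIncr, indicator_of_notMem h, abs_zero]
    exact indicator_nonneg (fun _ _ => by positivity) t

lemma integrableOn_abs_rpow_near (hs1 : s < 1) (ρ : ℝ) :
    IntegrableOn (fun t : ℝ => |t| ^ (-s)) {t | |t| < ρ} ∧
      (0 < ρ → ∫ t in {t : ℝ | |t| < ρ}, |t| ^ (-s) = 2 / (1 - s) * ρ ^ (1 - s)) := by
  have hset : {t : ℝ | |t| < ρ} = Ioo (-ρ) ρ := by ext t; simp [abs_lt]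
  have h1 : ∀ c : ℝ, IntervalIntegrable (fun t : ℝ => |t| ^ (-s)) volume 0 c := by
    have : ∀ c : ℝ, 0 ≤ c → IntervalIntegrable (fun t : ℝ => |t| ^ (-s)) volume 0 c := fun c hc =>
      (intervalIntegral.intervalIntegrable_rpow' (r := -s) (by linarith)).congr (fun t ht => by
        rw [uIoc_of_le hc] at ht
        simp only [abs_of_pos ht.1])
    intro c
    rcases le_total 0 c with hc | hc
    · exact this c hc
    · have := (IntervalIntegrable.iff_comp_neg (by simp)).1 (this (-c) (by linarith))
      simpa using this
  rw [hset]
  constructor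
  · have := ((h1 (-ρ)).symm.trans (h1 ρ)).1
    exact this.mono_set Ioo_subset_Ioc_self
  · intro hρ
    rw [← integral_Ioc_eq_integral_Ioo, ← intervalIntegral.integral_of_le (by linarith),
      ← intervalIntegral.integral_add_adjacent_intervals (h1 (-ρ)).symm (h1 ρ)]
    have e2 : ∫ t in (0 : ℝ)..ρ, |t| ^ (-s) = ρ ^ (1 - s) / (1 - s) := by
      have : ∫ t in (0 : ℝ)..ρ, |t| ^ (-s) = ∫ t in (0 : ℝ)..ρ, t ^ (-s) := by
        refine intervalIntegral.integral_congr fun t ht => ?_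
        rw [uIcc_of_le hρ.le] at ht
        simp only [abs_of_nonneg ht.1]
      rw [this, integral_rpow (Or.inl (by linarith)), Real.zero_rpow (by linarith), sub_zero,
        show -s + 1 = 1 - s by ring]
    have e1 : ∫ t in (-ρ)..0, |t| ^ (-s) = ∫ t in (0 : ℝ)..ρ, |t| ^ (-s) := by
      have := intervalIntegral.integral_comp_neg (a := 0) (b := ρ) (fun t : ℝ => |t| ^ (-s))
      simp only [abs_neg, neg_zero] at this
      exact this.symm
    rw [e1, e2]; ring

/-- The near integral is the full truncated one, which is nonnegative, minus the strictly negative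
part over `|t| ≥ ρ`. With one power of `|t|` less in the kernel, the integrand is dominated by
`|t|^(-s)`, whence `ρ^(1-s)`. -/
lemma nearIncr_integrals (hs0 : 0 < s) (hs1 : s < 1) (hp : 1 < p) {q ρ τ θ : ℝ} (hq0 : 1 / 2 ≤ q)
    (hq1 : q < 1) (hτ : 0 < τ) (hτρ : τ ≤ ρ) (hθ0 : 0 ≤ θ) (hθ : θ ^ s ≤ 1 / 4)
    (hτθ : τ ≤ θ * ρ) :
    Integrable (fun t => nearIncr s p q ρ τ t * |t| ^ (-1 - p * s)) ∧
    Integrable (fun t => nearIncr s p q ρ τ t * |t| ^ (-(p * s))) ∧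
    ((3 / 4) ^ (p - 1) - (1 / 4) ^ (p - 1)) / s * ρ ^ (-s) ≤
      ∫ t, nearIncr s p q ρ τ t * |t| ^ (-1 - p * s) ∧
    ∫ t, |nearIncr s p q ρ τ t| * |t| ^ (-(p * s)) ≤ 2 / (1 - s) * ρ ^ (1 - s) := by
  have hρ : 0 < ρ := hτ.trans_le hτρ
  have hq : 0 < q := by linarith
  have hint : IntegrableOn (fun t => incr s p τ t * |t| ^ (-1 - p * s)) (farSet q τ) :=
    (integrableOn_incr hs0 hs1.le hp hτ.le (c := (1 - q) * τ)
      (mul_pos (by linarith) hτ)).mono_set fun t ht => le_abs_of_mem_farSet hq hq1 hτ ht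
  have e : ∀ t, nearIncr s p q ρ τ t * |t| ^ (-1 - p * s) =
      (farSet q τ ∩ {t | |t| < ρ}).indicator (fun t => incr s p τ t * |t| ^ (-1 - p * s)) t := by
    intro t
    by_cases h : t ∈ farSet q τ ∩ {t | |t| < ρ}
    · rw [nearIncr, indicator_of_mem h, indicator_of_mem h]
    · rw [nearIncr, indicator_of_notMem h, indicator_of_notMem h, zero_mul]
  -- For `t ≥ ρ ≥ τ` one has `τ + t ≥ 2τ`, so `q ≥ 1/2` suffices.
  have hsub : {t : ℝ | ρ ≤ |t|} ⊆ farSet q τ := by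
    intro t ht
    rcases le_abs.1 (show ρ ≤ |t| from ht) with h | h
    · right; nlinarith
    · left; nlinarith
  have hdiff : farSet q τ ∩ {t | |t| < ρ} = farSet q τ \ {t | ρ ≤ |t|} := by
    ext t; simp [not_le]
  have hmeas : AEStronglyMeasurable (fun t => nearIncr s p q ρ τ t * |t| ^ (-(p * s))) volume := by
    refine Measurable.aestronglyMeasurable ?_
    have : Measurable (nearIncr s p q ρ τ) :=
      (measurable_incr τ).indicator (measurableSet_near q ρ τ)
    fun_prop
  have hms : MeasurableSet {t : ℝ | |t| < ρ} := measurableSet_lt (by fun_prop) (by fun_prop)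
  have hb : ∀ t, |nearIncr s p q ρ τ t| * |t| ^ (-(p * s)) ≤
      {t : ℝ | |t| < ρ}.indicator (fun t => |t| ^ (-s)) t := by
    intro t
    rcases eq_or_ne t 0 with rfl | ht
    · rw [abs_zero, Real.zero_rpow (by have := mul_pos (by linarith : 0 < p) hs0; linarith),
        mul_zero]
      exact indicator_nonneg (fun _ _ => by positivity) _
    have ht : 0 < |t| := abs_pos.2 ht
    refine (mul_le_mul_of_nonneg_right (abs_nearIncr_le hs0 hs1.le hp hτ.le t)
      (by positivity)).trans (le_of_eq ?_)
    by_cases h : t ∈ {t : ℝ | |t| < ρ}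
    · rw [indicator_of_mem h, indicator_of_mem h, ← Real.rpow_add ht]; congr 1; ring
    · rw [indicator_of_notMem h, indicator_of_notMem h, zero_mul]
  obtain ⟨hni, hnv⟩ := integrableOn_abs_rpow_near (s := s) hs1 ρ
  have hi2 : Integrable (fun t => nearIncr s p q ρ τ t * |t| ^ (-(p * s))) := by
    refine ((integrable_indicator_iff hms).2 hni).mono' hmeas
      (Filter.Eventually.of_forall fun t => ?_)
    rw [norm_mul, Real.norm_eq_abs, Real.norm_of_nonneg (by positivity)]
    exact hb t
  refine ⟨?_, hi2, ?_, ?_⟩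
  · simp only [e]
    exact (integrable_indicator_iff (measurableSet_near q ρ τ)).2 (hint.mono_set inter_subset_left)
  · simp only [e]
    rw [integral_indicator (measurableSet_near q ρ τ), hdiff,
      setIntegral_sdiff (measurableSet_le (by fun_prop) (by fun_prop)) hint hsub]
    have h1 := setIntegral_incr_nonneg hs0 hs1.le hp hq hq1 hτ
    have h2 := setIntegral_incr_far_le hs0 hp hs1.le hρ hθ0 hθ hτ hτθ
    linarith
  · rw [← hnv hρ, ← integral_indicator hms]
    refine integral_mono ?_ ((integrable_indicator_iff hms).2 hni) hb
    refine hi2.norm.congr (Filter.Eventually.of_forall fun t => ?_)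
    simp only [norm_mul, Real.norm_eq_abs]
    rw [abs_of_nonneg (show 0 ≤ |t| ^ (-(p * s)) by positivity)]

end Barrier

/-! ### Pointwise lower bound for the truncated operator. -/

section Lower

variable {n : ℕ} {s p : ℝ}

local notation "F" => EuclideanSpace ℝ (Fin n)
local notation "E" => EuclideanSpace ℝ (Fin (n + 1))

/-- Near the pole the barrier lies below the profile and agrees with it at `x`, so monotonicity of
the signed power suffices. In all other cases `‖x - y‖ ≥ ρ/2`, and there both barrier values are at
most `(4θ‖x - y‖)^s`, which the tail term pays for. -/
lemma flux_barrier_ge (hs0 : 0 < s) (hp : 1 < p) {q ρ θ r : ℝ} (hq0 : 0 < q)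
    (hq1 : q < 1) (hρ0 : 0 < ρ) (hρ : ρ ≤ 1 / 4) (hθ0 : 0 < θ) (hθ8 : θ ≤ 1 / 8) (hr : r = θ * ρ)
    {x : E} (hx : ‖x - pole n‖ < r) (hx1 : 1 < ‖x‖) (y : E) :
    nearIncr s p q ρ (height x) (height y - height x) *
        ‖x - y‖ ^ (-(((n + 1 : ℕ) : ℝ) + p * s)) -
      2 * (4 * θ) ^ (s * (p - 1)) * tailKer (((n + 1 : ℕ) : ℝ) + s) (ρ / 2) (x - y) ≤
    (heightFar n q).indicator (fun z => flux s p (barrier s r) z.1 z.2) (x, y) := by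
  have hr0 : 0 < r := hr ▸ mul_pos hθ0 hρ0
  have hr1 : r ≤ 1 / 16 := by nlinarith
  have hrρ : 8 * r ≤ ρ := by nlinarith
  have hτ := height_pos hr1 hx hx1
  have hτ2 := height_le hx
  have hwx : barrier s r x = height x ^ s := by rw [barrier, barrierBase_eq_height hr1 hx hx1]
  have hwx0 := barrier_nonneg (s := s) hr0.le x
  have hwy0 := barrier_nonneg (s := s) hr0.le y
  have hT := mul_nonneg (show 0 ≤ 2 * (4 * θ) ^ (s * (p - 1)) by positivity)
    (tailKer_nonneg (((n + 1 : ℕ) : ℝ) + s) (ρ / 2) (x - y))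
  by_cases hR : (x, y) ∈ heightFar n q
  swap
  · have : height y - height x ∉ farSet q (height x) ∩ {t | |t| < ρ} := fun h =>
      hR (mem_heightFar_iff.2 h.1)
    rw [indicator_of_notMem hR, nearIncr, indicator_of_notMem this, zero_mul]
    linarith
  have hD : 0 < ‖x - y‖ := lt_of_lt_of_le (by have : 0 < 1 - q := by linarith
                                              positivity)
    (le_norm_of_mem_heightFar hq0 hq1 hτ hR)
  rw [indicator_of_mem hR]
  set β := ((n + 1 : ℕ) : ℝ) + p * s with hβ
  have hflux : flux s p (barrier s r) x y =
      signedPow p (barrier s r x - barrier s r y) * ‖x - y‖ ^ (-β) := by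
    rw [flux, div_eq_mul_inv, Real.rpow_neg hD.le]
  have hK : 0 < ‖x - y‖ ^ (-β) := by positivity
  have hprof : ∀ t : ℝ, t = height y - height x → |t| < ρ → nearIncr s p q ρ (height x) t =
      signedPow p (barrier s r x - (max (height y) 0) ^ s) := by
    rintro t rfl ht
    have hm : height y - height x ∈ farSet q (height x) ∩ {t | |t| < ρ} :=
      ⟨mem_heightFar_iff.1 hR, ht⟩
    rw [nearIncr, indicator_of_mem hm, incr, add_sub_cancel, hwx]
  have far : ρ / 2 ≤ ‖x - y‖ →
      (barrier s r x ^ (p - 1) + barrier s r y ^ (p - 1)) * ‖x - y‖ ^ (-β) ≤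
        2 * (4 * θ) ^ (s * (p - 1)) * tailKer (((n + 1 : ℕ) : ℝ) + s) (ρ / 2) (x - y) := by
    intro hfar
    have hdx : extDist x ≤ r := by
      have h := abs_extDist_sub_le x (pole n)
      have h0 : extDist (pole n) = 0 := by simp [extDist]
      rw [h0, sub_zero] at h
      linarith [le_abs_self (extDist x)]
    have hdy : extDist y ≤ 2 * ‖x - y‖ := by
      have h := abs_extDist_sub_le x y
      linarith [neg_le_abs (extDist x - extDist y)]
    -- From `‖x - y‖ ≥ ρ/2 ≥ 4r` and `‖x - pole n‖ < r`; beyond `3r` the barrier has its small form.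
    have h3r : 3 * r ≤ ‖y - pole n‖ := by
      have := norm_sub_le_norm_sub_add_norm_sub x (pole n) y
      rw [norm_sub_rev (pole n) y] at this
      linarith
    have b1 : barrier s r x ≤ (4 * θ * ‖x - y‖) ^ s := by
      rw [hwx]
      exact Real.rpow_le_rpow hτ.le (by nlinarith) hs0.le
    have b2 : barrier s r y ≤ (4 * θ * ‖x - y‖) ^ s := by
      rw [barrier, barrierBase_far hr0.le h3r]
      refine Real.rpow_le_rpow (mul_nonneg hr0.le (extDist_nonneg y)) ?_ hs0.le
      have hrθ : r ≤ 2 * θ := by nlinarith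
      nlinarith [extDist_nonneg y]
    have hpow : ((4 * θ * ‖x - y‖) ^ s) ^ (p - 1) =
        (4 * θ) ^ (s * (p - 1)) * ‖x - y‖ ^ (s * (p - 1)) := by
      rw [← Real.rpow_mul (by positivity), Real.mul_rpow (by positivity) hD.le]
    have c1 := Real.rpow_le_rpow hwx0 b1 (by linarith : 0 ≤ p - 1)
    have c2 := Real.rpow_le_rpow hwy0 b2 (by linarith : 0 ≤ p - 1)
    rw [hpow] at c1 c2
    rw [tailKer, indicator_of_mem (by exact hfar)]
    have e : ‖x - y‖ ^ (-(((n + 1 : ℕ) : ℝ) + s)) = ‖x - y‖ ^ (s * (p - 1)) * ‖x - y‖ ^ (-β) := by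
      rw [← Real.rpow_add hD]; congr 1; rw [hβ]; ring
    rw [e, ← mul_assoc]
    refine mul_le_mul_of_nonneg_right ?_ hK.le
    linarith
  rw [hflux]
  rcases lt_or_ge |height y - height x| ρ with ht | ht
  · rw [hprof _ rfl ht]
    rcases lt_or_ge ‖y - pole n‖ (1 / 4) with hy | hy
    · have hwy : barrier s r y ≤ (max (height y) 0) ^ s :=
        Real.rpow_le_rpow (barrierBase_nonneg hr0.le y) (barrierBase_le_height (by linarith) hy)
          hs0.le
      have := mul_le_mul_of_nonneg_right (signedPow_mono hp (sub_le_sub_left hwy (barrier s r x)))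
        hK.le
      linarith
    · have hfar : ρ / 2 ≤ ‖x - y‖ := by
        have := norm_sub_le_norm_sub_add_norm_sub y x (pole n)
        rw [norm_sub_rev y x] at this
        linarith
      -- Far from the pole the extended graph is unrelated to the sphere, so the profile is
      -- exchanged for the barrier at the crude cost of both barrier powers.
      have h1 := mul_le_mul_of_nonneg_right (signedPow_sub_ge hp hwx0 hwy0
        (show 0 ≤ (max (height y) 0) ^ s by positivity)) hK.le
      have h2 := far hfar
      linarith
  · have hfar : ρ / 2 ≤ ‖x - y‖ := by
      have := abs_height_sub_le y x
      rw [norm_sub_rev] at this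
      linarith
    have hnm : height y - height x ∉ farSet q (height x) ∩ {t | |t| < ρ} := fun h =>
      absurd h.2 (not_lt.2 ht)
    rw [nearIncr, indicator_of_notMem hnm, zero_mul, zero_sub]
    have h2 := far hfar
    have h1 : -barrier s r y ^ (p - 1) ≤ signedPow p (barrier s r x - barrier s r y) := by
      rw [← signedPow_of_nonneg hp hwy0, ← signedPow_neg]
      exact signedPow_mono hp (by linarith)
    have h3 := mul_le_mul_of_nonneg_right h1 hK.le
    have h4 : 0 ≤ barrier s r x ^ (p - 1) * ‖x - y‖ ^ (-β) := by positivity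
    linarith

/-- In the chart centred at `x` the increment depends on `t` alone, so the tangent-plane comparison
applies with the Taylor constant 5 of `cap`. -/
lemma integral_nearIncr_ge (hn : 1 ≤ n) (hs0 : 0 < s) (hs1 : s < 1) (hp : 1 < p) {q ρ θ : ℝ}
    (hq0 : 1 / 2 ≤ q) (hq1 : q < 1) (hρ : 0 < ρ) (hθ0 : 0 ≤ θ) (hθ : θ ^ s ≤ 1 / 4) {x : E}
    (hx : ‖horiz x‖ ≤ 1 / 4) (hτ : 0 < height x) (hτρ : height x ≤ ρ) (hτθ : height x ≤ θ * ρ)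
    {β : ℝ} (hβ : β = ((n + 1 : ℕ) : ℝ) + p * s) :
    Integrable (fun y : E => nearIncr s p q ρ (height x) (height y - height x) *
        ‖x - y‖ ^ (-β)) ∧
    3 ^ (-(β / 2)) * marginal β (0 : F) *
        (((3 / 4) ^ (p - 1) - (1 / 4) ^ (p - 1)) / s * ρ ^ (-s)) -
      β / 2 * 3 ^ (β / 2 + 1) * (4 * 5) * marginal (β - 1) (0 : F) *
        (2 / (1 - s) * ρ ^ (1 - s)) ≤
      ∫ y : E, nearIncr s p q ρ (height x) (height y - height x) * ‖x - y‖ ^ (-β) := by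
  have hps : 0 < p * s := by positivity
  have hnR : (1 : ℝ) ≤ n := by exact_mod_cast hn
  have hβ' : β = n + 1 + p * s := by rw [hβ]; push_cast; ring
  obtain ⟨i1, i2, i3, i4⟩ := nearIncr_integrals hs0 hs1 hp hq0 hq1 hτ hτρ hθ0 hθ hτθ
  set a := nearIncr s p q ρ (height x) with ha
  have ham : Measurable a := (measurable_incr _).indicator (measurableSet_near q ρ _)
  have e1 : (n : ℝ) - β = -1 - p * s := by rw [hβ']; ring
  have e2 : (n : ℝ) + 1 - β = -(p * s) := by rw [hβ']; ring
  have hq : ∀ z : F, |cap (horiz x + z) - cap (horiz x)| ≤ ‖z‖ := fun z => by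
    simpa using abs_cap_sub_le (horiz x + z) (horiz x)
  have hqm : Measurable fun z : F => cap (horiz x + z) - cap (horiz x) := by
    have := (continuous_cap : Continuous (cap : F → ℝ)).measurable
    fun_prop
  have hmp := measurePreserving_chart x
  have hgm : Measurable fun y : E => a (height y - height x) * ‖x - y‖ ^ (-β) := by fun_prop
  have hcomp : ∀ w : F × ℝ, a (height (chart x w) - height x) * ‖x - chart x w‖ ^ (-β) =
      a w.2 * (‖w.1‖ ^ 2 + (w.2 + (cap (horiz x + w.1) - cap (horiz x))) ^ 2) ^ (-(β / 2)) := by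
    intro w
    rw [height_chart, add_sub_cancel_left, ← norm_sub_chart_sq, ← Real.rpow_natCast,
      ← Real.rpow_mul (norm_nonneg _)]
    congr 2; push_cast; ring
  have hi := integrable_mul_kernel' (n := n) (κ := β) (by linarith) ham (by rwa [e1]) hqm hq
  constructor
  · refine (hmp.integrable_comp hgm.aestronglyMeasurable).1 ?_
    exact hi.congr (Filter.Eventually.of_forall fun w => (hcomp w).symm)
  · have hint : ∫ y : E, a (height y - height x) * ‖x - y‖ ^ (-β) =
        ∫ w : F × ℝ, a w.2 * (‖w.1‖ ^ 2 + (w.2 + (cap (horiz x + w.1) - cap (horiz x))) ^ 2) ^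
          (-(β / 2)) ∂((volume : Measure F).prod volume) := by
      simp only [← hcomp]
      have := integral_map hmp.aemeasurable (f := fun y : E => a (height y - height x) *
        ‖x - y‖ ^ (-β)) (by rw [hmp.map_eq]; exact hgm.aestronglyMeasurable)
      rwa [hmp.map_eq] at this
    have hb := norm_capGrad_le hx
    have h := integral_mul_kernel_ge (n := n) (κ := β) (M := 5) (by linarith) (by linarith)
      (by norm_num) ham (by rwa [e1]) (by rwa [e2]) hqm hq hb (abs_cap_taylor_le hx)
    rw [e1, e2] at h
    rw [hint]
    refine le_trans ?_ h
    have hm := le_marginal (κ := β) (by linarith) hb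
    have hm1 := marginal_nonneg (β - 1) (0 : F)
    have hm0 := marginal_nonneg β (capGrad (horiz x))
    have hc0 : 0 ≤ ((3 / 4 : ℝ) ^ (p - 1) - (1 / 4) ^ (p - 1)) / s * ρ ^ (-s) := by
      have : (1 / 4 : ℝ) ^ (p - 1) ≤ (3 / 4) ^ (p - 1) :=
        Real.rpow_le_rpow (by norm_num) (by norm_num) (by linarith)
      have h2 := sub_nonneg.2 this
      positivity
    refine sub_le_sub (mul_le_mul hm i3 hc0 hm0) (mul_le_mul_of_nonneg_left i4 ?_)
    have : 0 ≤ β := by linarith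
    positivity

/-- Some radius and some positive constant bound the truncated operator from below, uniformly in
the truncation. -/
lemma exists_integral_flux_ge (hn : 1 ≤ n) (hs0 : 0 < s) (hs1 : s < 1) (hp : 1 < p) :
    ∃ r a : ℝ, 0 < r ∧ r ≤ 1 / 16 ∧ 0 < a ∧ ∀ x : E, ‖x - pole n‖ < r → 1 < ‖x‖ →
      ∀ q : ℝ, 1 / 2 ≤ q → q < 1 →
        a ≤ ∫ y : E, (heightFar n q).indicator
          (fun z => flux s p (barrier s r) z.1 z.2) (x, y) := by
  obtain ⟨β, hβ⟩ : ∃ β : ℝ, β = ((n + 1 : ℕ) : ℝ) + p * s := ⟨_, rfl⟩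
  have hps : 0 < p * s := by positivity
  have hβ' : β = n + 1 + p * s := by rw [hβ]; push_cast; ring
  -- After factoring out `ρ^(-s)`, the gain is `A`, the curvature loss is `Bρ` and the tail loss is
  -- `C(4θ)^(s(p-1))`. Each loss is made at most `A/4`.
  obtain ⟨A, hA⟩ : ∃ A : ℝ, A = 3 ^ (-(β / 2)) * marginal β (0 : F) *
        (((3 / 4) ^ (p - 1) - (1 / 4) ^ (p - 1)) / s) := ⟨_, rfl⟩
  obtain ⟨B, hB⟩ : ∃ B : ℝ, B = β / 2 * 3 ^ (β / 2 + 1) * (4 * 5) * marginal (β - 1) (0 : F) *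
        (2 / (1 - s)) := ⟨_, rfl⟩
  obtain ⟨C, hC⟩ : ∃ C : ℝ, C = 2 * (2 ^ s * ∫ z : E, tailKer (((n + 1 : ℕ) : ℝ) + s) 1 z) :=
    ⟨_, rfl⟩
  have hA0 : 0 < A := by
    have h1 := marginal_zero_pos (n := n) (κ := β) (by linarith)
    have h2 : (1 / 4 : ℝ) ^ (p - 1) < (3 / 4) ^ (p - 1) :=
      Real.rpow_lt_rpow (by norm_num) (by norm_num) (by linarith)
    have h3 := sub_pos.2 h2
    rw [hA]; positivity
  have hnn : (0 : ℝ) ≤ n := Nat.cast_nonneg n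
  have hB0 : 0 ≤ B := by
    have h1 := marginal_nonneg (β - 1) (0 : F)
    have h2 : 0 < 1 - s := by linarith
    have h3 : 0 ≤ β := by linarith
    rw [hB]; positivity
  obtain ⟨ρ, hρ0, hρ4, hρB⟩ : ∃ ρ : ℝ, 0 < ρ ∧ ρ ≤ 1 / 4 ∧ B * ρ ≤ A / 4 := by
    refine ⟨min (1 / 4) (A / 4 / (B + 1)), by positivity, min_le_left _ _, ?_⟩
    have h1 : min (1 / 4) (A / 4 / (B + 1)) ≤ A / 4 / (B + 1) := min_le_right _ _
    rw [le_div_iff₀ (by linarith)] at h1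
    have : 0 ≤ min (1 / 4) (A / 4 / (B + 1)) := by positivity
    nlinarith
  obtain ⟨θ, hθ0, hθ8, hθs, hθC⟩ : ∃ θ : ℝ, 0 < θ ∧ θ ≤ 1 / 8 ∧ (2 * θ) ^ s ≤ 1 / 4 ∧
      C * (4 * θ) ^ (s * (p - 1)) ≤ A / 4 := by
    have t1 : Filter.Tendsto (fun θ : ℝ => (2 * θ) ^ s) (nhdsWithin 0 (Ioi 0)) (nhds 0) := by
      have : Continuous fun θ : ℝ => (2 * θ) ^ s :=
        (by fun_prop : Continuous fun θ : ℝ => 2 * θ).rpow_const fun _ => Or.inr hs0.le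
      have := (this.tendsto 0).mono_left (nhdsWithin_le_nhds (s := Ioi (0 : ℝ)))
      simpa [Real.zero_rpow hs0.ne'] using this
    have hsp : 0 < s * (p - 1) := mul_pos hs0 (by linarith)
    have t2 : Filter.Tendsto (fun θ : ℝ => C * (4 * θ) ^ (s * (p - 1)))
        (nhdsWithin 0 (Ioi 0)) (nhds 0) := by
      have : Continuous fun θ : ℝ => C * (4 * θ) ^ (s * (p - 1)) :=
        continuous_const.mul
          ((by fun_prop : Continuous fun θ : ℝ => 4 * θ).rpow_const fun _ => Or.inr hsp.le)
      have := (this.tendsto 0).mono_left (nhdsWithin_le_nhds (s := Ioi (0 : ℝ)))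
      simpa [Real.zero_rpow hsp.ne'] using this
    have h8 : ∀ᶠ θ : ℝ in nhdsWithin 0 (Ioi 0), θ < 1 / 8 :=
      nhdsWithin_le_nhds (Iio_mem_nhds (by norm_num))
    have hpos : ∀ᶠ θ : ℝ in nhdsWithin 0 (Ioi 0), 0 < θ := self_mem_nhdsWithin
    obtain ⟨θ, h1, h2, h3, h4⟩ := (hpos.and (h8.and ((t1.eventually_lt_const
      (show (0 : ℝ) < 1 / 4 by norm_num)).and
        (t2.eventually_lt_const (show 0 < A / 4 by positivity))))).exists
    exact ⟨θ, h1, h2.le, h3.le, h4.le⟩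
  have hr1 : θ * ρ ≤ 1 / 16 := by nlinarith
  refine ⟨θ * ρ, A / 2 * ρ ^ (-s), by positivity, hr1, by positivity, ?_⟩
  intro x hx hx1 q hq0 hq1
  have hτ := height_pos hr1 hx hx1
  have hτ2 := height_le hx
  have hxh : ‖horiz x‖ ≤ 1 / 4 := norm_horiz_le_of_near (by linarith)
  -- The factor 2 appears because the height of `x` is only bounded by `2r = 2θρ`.
  obtain ⟨hi, hge⟩ := integral_nearIncr_ge hn hs0 hs1 hp hq0 hq1 hρ0 (θ := 2 * θ) (by linarith)
    hθs hxh hτ (by nlinarith) (by linarith) hβ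
  have hpw := flux_barrier_ge hs0 hp (by linarith) hq1 hρ0 hρ4 hθ0 hθ8 rfl hx hx1 (p := p)
  rw [← hβ] at hpw
  have hit := (integrable_tailKer_sub (finrank_lt (n := n) hs0) (half_pos hρ0) x).const_mul
    (2 * (4 * θ) ^ (s * (p - 1)))
  have hmono := integral_mono (hi.sub hit) (integrable_indicator_flux hs0 hs1.le hp
    (by positivity) (by linarith) (by linarith) hq1 hτ) hpw
  have hsub := integral_sub hi hit
  simp only [Pi.sub_apply] at hmono
  rw [hsub, integral_const_mul, integral_tailKer_sub (half_pos hρ0), finrank_euclideanSpace,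
    Fintype.card_fin, show (((n + 1 : ℕ) : ℝ) - (((n + 1 : ℕ) : ℝ) + s)) = -s by ring] at hmono
  refine le_trans ?_ hmono
  have eρ : (ρ / 2) ^ (-s) = 2 ^ s * ρ ^ (-s) := by
    rw [Real.div_rpow hρ0.le (by norm_num), Real.rpow_neg (by norm_num : (0 : ℝ) ≤ 2), div_inv_eq_mul]
    ring
  have eρ1 : ρ ^ (1 - s) = ρ * ρ ^ (-s) := by
    rw [sub_eq_add_neg, Real.rpow_add hρ0, Real.rpow_one]
  have e1 : 3 ^ (-(β / 2)) * marginal β (0 : F) *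
        (((3 / 4) ^ (p - 1) - (1 / 4) ^ (p - 1)) / s * ρ ^ (-s)) = A * ρ ^ (-s) := by
    rw [hA]; ring
  have e2 : β / 2 * 3 ^ (β / 2 + 1) * (4 * 5) * marginal (β - 1) (0 : F) *
        (2 / (1 - s) * ρ ^ (1 - s)) = B * ρ * ρ ^ (-s) := by rw [hB, eρ1]; ring
  have e3 : 2 * (4 * θ) ^ (s * (p - 1)) * ((ρ / 2) ^ (-s) *
      ∫ z : E, tailKer (((n + 1 : ℕ) : ℝ) + s) 1 z) =
      C * (4 * θ) ^ (s * (p - 1)) * ρ ^ (-s) := by rw [hC, eρ]; ring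
  rw [e1, e2] at hge
  rw [e3]
  have hρs : 0 < ρ ^ (-s) := by positivity
  nlinarith [mul_le_mul_of_nonneg_right hρB hρs.le, mul_le_mul_of_nonneg_right hθC hρs.le]

end Lower

/-! ### Integrability of convolution integrands. -/

section Convolution

variable {E : Type*} [NormedAddCommGroup E] [InnerProductSpace ℝ E] [FiniteDimensional ℝ E]
  [MeasurableSpace E] [BorelSpace E]

lemma integrable_snd_mul_sub {f g : E → ℝ} (hf : Integrable f) (hg : Integrable g) :
    Integrable (fun z : E × E => f z.2 * g (z.1 - z.2))
      ((volume : Measure E).prod volume) :=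
  hf.convolution_integrand (ContinuousLinearMap.mul ℝ ℝ) hg

lemma integrable_fst_mul_sub {f g : E → ℝ} (hf : Integrable f) (hg : Integrable g)
    (hge : ∀ z, g (-z) = g z) :
    Integrable (fun z : E × E => f z.1 * g (z.1 - z.2))
      ((volume : Measure E).prod volume) := by
  refine (integrable_snd_mul_sub hf hg).swap.congr (Filter.Eventually.of_forall fun z => ?_)
  simp only [Function.comp_apply, Prod.fst_swap, Prod.snd_swap]
  rw [← neg_sub, hge]

end Convolution

/-! ### Membership of the barrier in the function spaces. -/

section Space

variable {n : ℕ} {s p r : ℝ}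

local notation "E" => EuclideanSpace ℝ (Fin (n + 1))

lemma integrable_norm_rpow_ball {α : ℝ} (hα : 0 < α) (R : ℝ) :
    Integrable fun z : E => (Iio R).indicator (fun t => t ^ (α - ((n + 1 : ℕ) : ℝ))) ‖z‖ := by
  rw [integrable_fun_norm_addHaar volume
    (f := (Iio R).indicator (fun t : ℝ => t ^ (α - ((n + 1 : ℕ) : ℝ)))), finrank_euclideanSpace,
    Fintype.card_fin, Nat.add_sub_cancel]
  rcases le_or_gt R 0 with hR | hR
  · refine (integrableOn_zero).congr_fun (fun t ht => ?_) measurableSet_Ioi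
    have ht : 0 < t := ht
    rw [indicator_of_notMem (by simpa using hR.trans ht.le), smul_zero]
  have h := (intervalIntegrable_iff_integrableOn_Ioo_of_le hR.le).1
    (intervalIntegral.intervalIntegrable_rpow' (a := 0) (b := R) (r := α - 1) (by linarith))
  rw [← integrable_indicator_iff measurableSet_Ioo] at h
  rw [← integrable_indicator_iff measurableSet_Ioi]
  refine h.congr (Filter.Eventually.of_forall fun t => ?_)
  by_cases h0 : 0 < t
  · by_cases h1 : t < R
    · simp only [indicator, mem_Ioo, mem_Ioi, mem_Iio, h0, h1, and_self, if_true, smul_eq_mul]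
      rw [← Real.rpow_natCast, ← Real.rpow_add h0]
      congr 1; push_cast; ring
    · simp only [indicator, mem_Ioo, mem_Ioi, mem_Iio, h0, h1, and_false, if_true, if_false,
        smul_zero]
  · simp only [indicator, mem_Ioo, mem_Ioi, h0, false_and, if_false]

/-- In polar coordinates the only singularity is at radius one, integrable since `α < 1`. Inside the
unit ball the integrand is `0 ^ (-α) = 0` by convention. -/
lemma integrable_extDist_rpow {α : ℝ} (hα0 : 0 < α) (hα1 : α < 1) (R : ℝ) :
    Integrable fun x : E => (Iio R).indicator (fun t => (max (t - 1) 0) ^ (-α)) ‖x‖ := by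
  rw [integrable_fun_norm_addHaar volume
    (f := (Iio R).indicator (fun t : ℝ => (max (t - 1) 0) ^ (-α))), finrank_euclideanSpace,
    Fintype.card_fin, Nat.add_sub_cancel]
  have h := (integrableOn_abs_rpow_near (s := α) hα1 |R|).1
  have hms : MeasurableSet {t : ℝ | |t| < |R|} :=
    measurableSet_lt (measurable_id.abs) measurable_const
  rw [← integrable_indicator_iff hms] at h
  have h2 := ((h.comp_sub_right 1).const_mul (|R| ^ n)).integrableOn (s := Ioi 0)
  refine h2.mono' (Measurable.aestronglyMeasurable ?_) ?_
  · have h3 : Measurable ((Iio R).indicator fun t : ℝ => (max (t - 1) 0) ^ (-α)) :=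
      Measurable.indicator (by fun_prop) measurableSet_Iio
    exact (measurable_id.pow_const n).smul h3
  · filter_upwards [ae_restrict_mem measurableSet_Ioi] with t ht
    have ht : 0 < t := ht
    have hrhs : 0 ≤ |R| ^ n * {t : ℝ | |t| < |R|}.indicator (fun t => |t| ^ (-α)) (t - 1) :=
      mul_nonneg (by positivity) (indicator_nonneg (fun _ _ => by positivity) _)
    by_cases h1 : t < R
    · rw [indicator_of_mem (by exact h1), norm_smul, norm_pow, Real.norm_of_nonneg ht.le,
        Real.norm_of_nonneg (by positivity)]
      rcases le_or_gt t 1 with h3 | h3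
      · rw [max_eq_right (by linarith), Real.zero_rpow (by linarith), mul_zero]
        exact hrhs
      · have hm : t - 1 ∈ {t : ℝ | |t| < |R|} := by
          show |t - 1| < |R|
          rw [abs_of_pos (by linarith), abs_of_pos (by linarith)]; linarith
        rw [indicator_of_mem hm, max_eq_left (by linarith), abs_of_pos (by linarith : 0 < t - 1)]
        refine mul_le_mul_of_nonneg_right ?_ (Real.rpow_nonneg (by linarith) _)
        exact pow_le_pow_left₀ ht.le (h1.le.trans (le_abs_self R)) n
    · rw [indicator_of_notMem (by exact h1), smul_zero, norm_zero]
      exact hrhs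

/-- Hölder continuity alone just fails to give a finite seminorm. With `M` the larger base value and
`δ ≤ M` the difference, `(δ M^(s-1))^p ≤ δ^(ps+α) M^(-α)`: an extra power `α` of the distance is
bought with an integrable singularity at the sphere. -/
lemma barrier_diff_pow_le (hs0 : 0 < s) (hs1 : s < 1) (hp : 1 < p) (hr0 : 0 < r) (hr1 : r ≤ 1 / 16)
    {α : ℝ} (hα0 : 0 < α) (hα : α ≤ p * (1 - s)) (x y : E) :
    |barrier s r x - barrier s r y| ^ p ≤ (2 * ‖x - y‖) ^ (p * s + α) *
      (r ^ (-α) * (extDist x ^ (-α) + extDist y ^ (-α))) := by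
  wlog hxy : barrierBase r y ≤ barrierBase r x generalizing x y
  · rw [abs_sub_comm, norm_sub_rev, add_comm (extDist x ^ (-α))]
    exact this y x (le_of_not_ge hxy)
  have hy0 := barrierBase_nonneg hr0.le y
  have hx0 := barrierBase_nonneg hr0.le x
  have hdx := extDist_nonneg x
  have hdy := extDist_nonneg y
  have hp0 : 0 < p := by linarith
  rcases eq_or_lt_of_le hx0 with hx | hx
  · have hy : barrierBase r y = 0 := le_antisymm (hx ▸ hxy) hy0
    rw [barrier, barrier, hy, ← hx, sub_self, abs_zero, Real.zero_rpow hp0.ne']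
    positivity
  have hd : 0 < extDist x := by
    have := barrierBase_le hr0.le hr1 x
    linarith
  set M := barrierBase r x with hM
  set δ := M - barrierBase r y with hδ
  have hδ0 : 0 ≤ δ := sub_nonneg.2 hxy
  have hδM : δ ≤ M := by linarith
  have h1 : |barrier s r x - barrier s r y| ≤ δ * M ^ (s - 1) := by
    have := abs_rpow_sub_rpow_le_mul hs0 hs1.le hx0 hy0 hxy
    rwa [abs_of_nonneg hδ0] at this
  have hδn : δ ≤ 2 * ‖x - y‖ :=
    (le_abs_self _).trans (abs_barrierBase_sub_le hr0.le (by linarith) x y)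
  have h2 : (δ * M ^ (s - 1)) ^ p ≤ δ ^ (p * s + α) * M ^ (-α) := by
    rw [Real.mul_rpow hδ0 (by positivity), ← Real.rpow_mul hx.le]
    have e1 : δ ^ p = δ ^ (p * s + α) * δ ^ (p * (1 - s) - α) := by
      rw [← Real.rpow_add_of_nonneg hδ0 (by positivity) (by linarith)]; congr 1; ring
    have e2 : M ^ (-α) = M ^ (p * (1 - s) - α) * M ^ ((s - 1) * p) := by
      rw [← Real.rpow_add hx]; congr 1; ring
    rw [e1, e2, mul_assoc]
    refine mul_le_mul_of_nonneg_left (mul_le_mul_of_nonneg_right ?_ (by positivity)) (by positivity)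
    exact Real.rpow_le_rpow hδ0 hδM (by linarith)
  have h3 : M ^ (-α) ≤ r ^ (-α) * (extDist x ^ (-α) + extDist y ^ (-α)) := by
    have : M ^ (-α) ≤ (r * extDist x) ^ (-α) :=
      Real.rpow_le_rpow_of_nonpos (by positivity) (barrierBase_ge x) (by linarith)
    rw [Real.mul_rpow hr0.le hdx] at this
    refine this.trans (mul_le_mul_of_nonneg_left ?_ (by positivity))
    have : 0 ≤ extDist y ^ (-α) := by positivity
    linarith
  calc |barrier s r x - barrier s r y| ^ p ≤ (δ * M ^ (s - 1)) ^ p :=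
        Real.rpow_le_rpow (abs_nonneg _) h1 hp0.le
    _ ≤ δ ^ (p * s + α) * M ^ (-α) := h2
    _ ≤ _ := mul_le_mul (Real.rpow_le_rpow hδ0 hδn (by positivity)) h3 (by positivity)
        (by positivity)

lemma gagliardo_barrier_lt_top (hs0 : 0 < s) (hs1 : s < 1) (hp : 1 < p) (hr0 : 0 < r)
    (hr1 : r ≤ 1 / 16) (R : ℝ) :
    gagliardo s p (Metric.ball (0 : E) R) (barrier s r) < ∞ := by
  obtain ⟨α, hα0, hα1, hαp⟩ : ∃ α : ℝ, 0 < α ∧ α < 1 ∧ α ≤ p * (1 - s) := by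
    have : 0 < p * (1 - s) := mul_pos (by linarith) (by linarith)
    exact ⟨min (1 / 2) (p * (1 - s)), by positivity,
      (min_le_left _ _).trans_lt (by norm_num), min_le_right _ _⟩
  set m := ((n + 1 : ℕ) : ℝ) with hm
  set f : E → ℝ := fun x => (Iio R).indicator (fun t => (max (t - 1) 0) ^ (-α)) ‖x‖ with hf
  set g : E → ℝ := fun z => (Iio (2 * R)).indicator (fun t => t ^ (α - m)) ‖z‖ with hg
  have hfi : Integrable f := integrable_extDist_rpow hα0 hα1 R
  have hgi : Integrable g := integrable_norm_rpow_ball hα0 (2 * R)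
  have hG := ((integrable_fst_mul_sub hfi hgi (fun z => by simp [hg])).add
    (integrable_snd_mul_sub hfi hgi)).const_mul (2 ^ (p * s + α) * r ^ (-α))
  have hlt := hG.lintegral_lt_top
  refine lt_of_le_of_lt ?_ hlt
  refine le_trans (setLIntegral_mono' (measurableSet_ball.prod measurableSet_ball)
    (fun z hz => ENNReal.ofReal_le_ofReal ?_)) (setLIntegral_le_lintegral _ _)
  obtain ⟨x, y⟩ := z
  have hx : ‖x‖ < R := by simpa using hz.1
  have hy : ‖y‖ < R := by simpa using hz.2
  simp only [Pi.add_apply]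
  have hfx : f x = extDist x ^ (-α) := by simp only [hf]; rw [indicator_of_mem (by exact hx), extDist]
  have hfy : f y = extDist y ^ (-α) := by simp only [hf]; rw [indicator_of_mem (by exact hy), extDist]
  have hgz : g (x - y) = ‖x - y‖ ^ (α - m) := by
    simp only [hg]
    rw [indicator_of_mem]
    exact lt_of_le_of_lt (norm_sub_le x y) (by linarith)
  have hdx := extDist_nonneg x
  have hdy := extDist_nonneg y
  rw [hfx, hfy, hgz]
  rcases eq_or_ne x y with rfl | hxy
  · rw [sub_self, abs_zero, Real.zero_rpow (by linarith), zero_div]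
    positivity
  have hD : 0 < ‖x - y‖ := norm_pos_iff.2 (sub_ne_zero.2 hxy)
  rw [div_eq_mul_inv, ← Real.rpow_neg hD.le]
  refine (mul_le_mul_of_nonneg_right (barrier_diff_pow_le hs0 hs1 hp hr0 hr1 hα0 hαp x y)
    (by positivity)).trans (le_of_eq ?_)
  have e : ‖x - y‖ ^ (α - m) = ‖x - y‖ ^ (p * s + α) * ‖x - y‖ ^ (-(m + p * s)) := by
    rw [← Real.rpow_add hD]; congr 1; ring
  rw [Real.mul_rpow (by norm_num) hD.le, e]
  ring

lemma memLp_barrier (hs0 : 0 < s) {K : Set E} (hK : IsCompact K) (q : ℝ≥0∞) :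
    MemLp (barrier s r) q (volume.restrict K) := by
  have hc := continuous_barrier (n := n) (r := r) hs0
  obtain ⟨C, hC⟩ := hK.exists_bound_of_continuousOn hc.continuousOn
  have : IsFiniteMeasure ((volume : Measure E).restrict K) :=
    ⟨by rw [Measure.restrict_apply_univ]; exact hK.measure_lt_top⟩
  refine MemLp.of_bound hc.aestronglyMeasurable C ?_
  filter_upwards [ae_restrict_mem hK.measurableSet] with x hx using hC x hx

lemma memW_barrier (hs0 : 0 < s) (hs1 : s < 1) (hp : 1 < p) (hr0 : 0 < r) (hr1 : r ≤ 1 / 16)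
    (R : ℝ) : MemW s p (Metric.ball (0 : E) R) (barrier s r) :=
  ⟨(memLp_barrier hs0 (isCompact_closedBall (0 : E) R) _).mono_measure
    (Measure.restrict_mono Metric.ball_subset_closedBall le_rfl),
    gagliardo_barrier_lt_top hs0 hs1 hp hr0 hr1 R⟩

lemma barrier_le (hs0 : 0 < s) (hr0 : 0 ≤ r) (hr1 : r ≤ 1 / 16) (x : E) :
    barrier s r x ≤ 2 ^ s * extDist x ^ s := by
  rw [← Real.mul_rpow (by norm_num) (extDist_nonneg x)]
  exact Real.rpow_le_rpow (barrierBase_nonneg hr0 x) (barrierBase_le hr0 hr1 x) hs0.le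

lemma le_barrier (hs0 : 0 < s) (hr0 : 0 ≤ r) (x : E) :
    r ^ s * extDist x ^ s ≤ barrier s r x := by
  rw [← Real.mul_rpow hr0 (extDist_nonneg x)]
  exact Real.rpow_le_rpow (mul_nonneg hr0 (extDist_nonneg x)) (barrierBase_ge x) hs0.le

lemma integrable_tail_barrier (hs0 : 0 < s) (hp : 1 < p) (hr0 : 0 ≤ r) (hr1 : r ≤ 1 / 16) :
    Integrable fun x : E => |barrier s r x| ^ (p - 1) /
      (1 + ‖x‖) ^ (((n + 1 : ℕ) : ℝ) + p * s) := by
  have h := (integrable_one_add_norm (μ := (volume : Measure E)) (finrank_lt (n := n) hs0)).const_mul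
    (2 ^ (s * (p - 1)))
  refine h.mono' (Measurable.aestronglyMeasurable ?_) (Filter.Eventually.of_forall fun x => ?_)
  · have := (continuous_barrier (n := n) (r := r) hs0).measurable
    fun_prop
  have h1 : 0 < 1 + ‖x‖ := by positivity
  have hd : extDist x ≤ 1 + ‖x‖ := max_le (by linarith) h1.le
  have hb : |barrier s r x| ≤ (2 * (1 + ‖x‖)) ^ s := by
    rw [abs_of_nonneg (barrier_nonneg hr0 x)]
    refine Real.rpow_le_rpow (barrierBase_nonneg hr0 x) ?_ hs0.le
    have := barrierBase_le hr0 hr1 x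
    linarith
  have hb' : |barrier s r x| ^ (p - 1) ≤ 2 ^ (s * (p - 1)) * (1 + ‖x‖) ^ (s * (p - 1)) := by
    rw [← Real.mul_rpow (by norm_num) h1.le, Real.rpow_mul (by positivity)]
    exact Real.rpow_le_rpow (abs_nonneg _) hb (by linarith)
  rw [Real.norm_of_nonneg (by positivity), div_eq_mul_inv, ← Real.rpow_neg h1.le]
  refine (mul_le_mul_of_nonneg_right hb' (by positivity)).trans (le_of_eq ?_)
  rw [mul_assoc, ← Real.rpow_add h1]
  congr 2; ring

/-- The part outside the closed unit ball of the ball of radius `r` around the north pole. -/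
def capDomain (n : ℕ) (r : ℝ) : Set (EuclideanSpace ℝ (Fin (n + 1))) :=
  Metric.ball (pole n) r \ Metric.closedBall 0 1

lemma mem_capDomain {x : E} : x ∈ capDomain n r ↔ ‖x - pole n‖ < r ∧ 1 < ‖x‖ := by
  simp [capDomain, dist_eq_norm]

lemma norm_lt_two_of_mem (hr1 : r ≤ 1 / 16) {x : E} (hx : x ∈ capDomain n r) : ‖x‖ < 2 := by
  have h := norm_le_norm_add_norm_sub' x (pole n)
  rw [norm_pole] at h
  have := (mem_capDomain.1 hx).1
  linarith

lemma memWTilde_barrier (hs0 : 0 < s) (hs1 : s < 1) (hp : 1 < p) (hr0 : 0 < r)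
    (hr1 : r ≤ 1 / 16) : MemWTilde s p (capDomain n r) (barrier s r) := by
  have hsub : closure (capDomain n r) ⊆ Metric.closedBall 0 2 :=
    closure_minimal (fun x hx => by simpa using (norm_lt_two_of_mem hr1 hx).le)
      Metric.isClosed_closedBall
  refine ⟨fun K hK => memLp_barrier hs0 hK _, ⟨Metric.ball 0 3, Metric.isOpen_ball,
    (isCompact_closedBall 0 2).of_isClosed_subset isClosed_closure hsub,
    hsub.trans (Metric.closedBall_subset_ball (by norm_num)),
    memW_barrier hs0 hs1 hp hr0 hr1 3⟩, integrable_tail_barrier hs0 hp hr0.le hr1⟩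

lemma exists_holderWith_barrier (hs0 : 0 < s) (hs1 : s ≤ 1) (hr0 : 0 ≤ r) (hr1 : r ≤ 1) :
    ∃ C : ℝ≥0, HolderWith C s.toNNReal (barrier s r : E → ℝ) := by
  refine ⟨Real.toNNReal (2 ^ s), fun x y => ?_⟩
  have h := abs_barrier_sub_le hs0 hs1 hr0 hr1 x y
  rw [edist_dist, edist_dist, Real.dist_eq, dist_eq_norm, Real.coe_toNNReal s hs0.le,
    ENNReal.ofReal_rpow_of_nonneg (norm_nonneg _) hs0.le]
  refine (ENNReal.ofReal_le_ofReal (h.trans_eq (Real.mul_rpow (by norm_num) (norm_nonneg _)))).trans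
    (le_of_eq ?_)
  rw [ENNReal.ofReal_mul (by positivity)]
  rfl

end Space

/-! ### From the pointwise bound to the weak inequality. -/

section Weak

variable {n : ℕ} {s p r : ℝ}

local notation "E" => EuclideanSpace ℝ (Fin (n + 1))

lemma flux_swap {N : ℕ} (u : EuclideanSpace ℝ (Fin N) → ℝ) (x y : EuclideanSpace ℝ (Fin N)) :
    flux s p u y x = -flux s p u x y := by
  rw [flux, flux, ← neg_sub (u x), signedPow_neg, norm_sub_rev, neg_div]

lemma weakIntegrand_eq {N : ℕ} (u φ : EuclideanSpace ℝ (Fin N) → ℝ)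
    (x y : EuclideanSpace ℝ (Fin N)) :
    weakIntegrand s p u φ (x, y) = flux s p u x y * φ x + flux s p u y x * φ y := by
  rw [flux_swap u x y, weakIntegrand, flux]
  ring

lemma mem_heightFar_swap {q : ℝ} {x y : E} : (y, x) ∈ heightFar n q ↔ (x, y) ∈ heightFar n q := by
  simp only [heightFar, mem_ofPred_eq]
  exact or_comm

variable {φ : EuclideanSpace ℝ (Fin (n + 1)) → ℝ}

lemma integrable_test (hp : 1 < p) (hφ : MemW0 s p (capDomain n r) φ) : Integrable φ := by
  have h1 : MemLp φ (ENNReal.ofReal p) (volume.restrict (capDomain n r)) :=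
    hφ.1.1.mono_measure (Measure.restrict_mono (subset_univ _) le_rfl)
  have : IsFiniteMeasure ((volume : Measure E).restrict (capDomain n r)) := ⟨by
    rw [Measure.restrict_apply_univ]
    exact (measure_mono sdiff_subset).trans_lt measure_ball_lt_top⟩
  have h2 : IntegrableOn φ (capDomain n r) :=
    h1.integrable (by rw [← ENNReal.ofReal_one]; exact ENNReal.ofReal_le_ofReal hp.le)
  exact h2.integrable_of_ae_notMem_eq_zero hφ.2

lemma ae_fst {P : E → Prop} (h : ∀ᵐ x, P x) :
    ∀ᵐ z : E × E ∂((volume : Measure E).prod volume), P z.1 :=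
  Measure.quasiMeasurePreserving_fst.ae h

lemma ae_snd {P : E → Prop} (h : ∀ᵐ x, P x) :
    ∀ᵐ z : E × E ∂((volume : Measure E).prod volume), P z.2 :=
  Measure.quasiMeasurePreserving_snd.ae h

lemma integrableOn_gagliardo {U : Set E} {u : E → ℝ} (hU : MeasurableSet U)
    (hu : AEStronglyMeasurable u) (h : gagliardo s p U u < ∞) :
    Integrable ((U ×ˢ U).indicator fun z : E × E =>
      |u z.1 - u z.2| ^ p / ‖z.1 - z.2‖ ^ (((n + 1 : ℕ) : ℝ) + p * s))
      ((volume : Measure E).prod volume) := by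
  rw [integrable_indicator_iff (hU.prod hU)]
  have h1 : AEMeasurable (fun z : E × E => u z.1) ((volume : Measure E).prod volume) :=
    hu.aemeasurable.comp_quasiMeasurePreserving Measure.quasiMeasurePreserving_fst
  have h2 : AEMeasurable (fun z : E × E => u z.2) ((volume : Measure E).prod volume) :=
    hu.aemeasurable.comp_quasiMeasurePreserving Measure.quasiMeasurePreserving_snd
  have h3 : AEMeasurable (fun z : E × E => |u z.1 - u z.2| ^ p /
      ‖z.1 - z.2‖ ^ (((n + 1 : ℕ) : ℝ) + p * s)) ((volume : Measure E).prod volume) := by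
    refine AEMeasurable.div ?_ (by fun_prop)
    exact ((h1.sub h2).abs).pow_const p
  refine (lintegral_ofReal_ne_top_iff_integrable h3.restrict.aestronglyMeasurable
    (Filter.Eventually.of_forall fun z => by positivity)).1 h.ne

lemma rpow_mul_le_add {a b : ℝ} (hp : 1 < p) (ha : 0 ≤ a) (hb : 0 ≤ b) :
    a ^ (p - 1) * b ≤ a ^ p + b ^ p := by
  have hp1 : 0 ≤ p - 1 := by linarith
  have key : ∀ c : ℝ, 0 ≤ c → c ^ p = c ^ (p - 1) * c := fun c hc => by
    rw [← Real.rpow_add_one' hc (by linarith)]; congr 1; ring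
  rcases le_total a b with h | h
  · have h1 := mul_le_mul_of_nonneg_right (Real.rpow_le_rpow ha h hp1) hb
    rw [← key b hb] at h1
    have : 0 ≤ a ^ p := by positivity
    linarith
  · have h1 := mul_le_mul_of_nonneg_left h (show 0 ≤ a ^ (p - 1) by positivity)
    rw [← key a ha] at h1
    have : 0 ≤ b ^ p := by positivity
    linarith

lemma aestronglyMeasurable_weakIntegrand (hs0 : 0 < s) (hφ : AEStronglyMeasurable φ) :
    AEStronglyMeasurable (weakIntegrand s p (barrier s r) φ)
      ((volume : Measure E).prod volume) := by
  have h1 : AEMeasurable (fun z : E × E => φ z.1) ((volume : Measure E).prod volume) :=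
    hφ.aemeasurable.comp_quasiMeasurePreserving Measure.quasiMeasurePreserving_fst
  have h2 : AEMeasurable (fun z : E × E => φ z.2) ((volume : Measure E).prod volume) :=
    hφ.aemeasurable.comp_quasiMeasurePreserving Measure.quasiMeasurePreserving_snd
  have hw := (continuous_barrier (n := n) (r := r) hs0).measurable
  have h3 : AEMeasurable (fun z : E × E => signedPow p (barrier s r z.1 - barrier s r z.2))
      ((volume : Measure E).prod volume) := Measurable.aemeasurable (by fun_prop)
  exact ((h3.mul (h1.sub h2)).div (Measurable.aemeasurable (by fun_prop))).aestronglyMeasurable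

/-- When both points lie in the ball of radius 3, a Young-type inequality reduces to the two
Gagliardo seminorms. Otherwise the integrand vanishes, or one point has norm below 2 and the other
at least 3, so the flux is bounded by an integrable tail. -/
lemma integrable_weakIntegrand (hs0 : 0 < s) (hs1 : s < 1) (hp : 1 < p) (hr0 : 0 < r)
    (hr1 : r ≤ 1 / 16) (hφ : MemW0 s p (capDomain n r) φ) :
    Integrable (weakIntegrand s p (barrier s r) φ) ((volume : Measure E).prod volume) := by
  have hφi := integrable_test hp hφ
  set β := ((n + 1 : ℕ) : ℝ) + p * s with hβ
  have g1 := integrableOn_gagliardo (n := n) (s := s) (p := p) measurableSet_ball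
    (continuous_barrier hs0).aestronglyMeasurable (memW_barrier hs0 hs1 hp hr0 hr1 3).2
  have g2 := integrableOn_gagliardo (n := n) (s := s) (p := p) MeasurableSet.univ
    hφi.aestronglyMeasurable hφ.1.2
  have ht : Integrable (tailKer (((n + 1 : ℕ) : ℝ) + s) 1 : E → ℝ) :=
    integrable_tailKer (finrank_lt hs0) one_pos
  have g3 := integrable_fst_mul_sub hφi.norm ht (fun z => by simp [tailKer, indicator])
  have g4 := integrable_snd_mul_sub hφi.norm ht
  refine ((g1.add g2).add ((g3.add g4).const_mul (2 ^ (s * (p - 1))))).mono'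
    (aestronglyMeasurable_weakIntegrand hs0 hφi.aestronglyMeasurable) ?_
  filter_upwards [ae_fst hφ.2, ae_snd hφ.2] with z hz1 hz2
  obtain ⟨x, y⟩ := z
  simp only at hz1 hz2
  simp only [Pi.add_apply, univ_prod_univ, indicator_univ]
  have t0 := tailKer_nonneg (((n + 1 : ℕ) : ℝ) + s) 1 (x - y)
  have n1 : 0 ≤ (Metric.ball (0 : E) 3 ×ˢ Metric.ball (0 : E) 3).indicator (fun z : E × E =>
      |barrier s r z.1 - barrier s r z.2| ^ p / ‖z.1 - z.2‖ ^ β) (x, y) :=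
    indicator_nonneg (fun _ _ => by positivity) _
  have n2 : 0 ≤ |φ x - φ y| ^ p / ‖x - y‖ ^ β := by positivity
  have n3 : 0 ≤ 2 ^ (s * (p - 1)) * (‖φ x‖ * tailKer (((n + 1 : ℕ) : ℝ) + s) 1 (x - y) +
      ‖φ y‖ * tailKer (((n + 1 : ℕ) : ℝ) + s) 1 (x - y)) := by positivity
  have hnorm : ‖weakIntegrand s p (barrier s r) φ (x, y)‖ =
      |barrier s r x - barrier s r y| ^ (p - 1) * |φ x - φ y| / ‖x - y‖ ^ β := by
    rw [weakIntegrand, norm_div, norm_mul, Real.norm_eq_abs, abs_signedPow hp, Real.norm_eq_abs,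
      Real.norm_of_nonneg (show 0 ≤ ‖x - y‖ ^ β by positivity)]
  by_cases hV : (x, y) ∈ Metric.ball (0 : E) 3 ×ˢ Metric.ball (0 : E) 3
  · rw [indicator_of_mem hV, hnorm]
    have h := rpow_mul_le_add hp (abs_nonneg (barrier s r x - barrier s r y))
      (abs_nonneg (φ x - φ y))
    have h' := div_le_div_of_nonneg_right h (show 0 ≤ ‖x - y‖ ^ β by positivity)
    rw [add_div] at h'
    linarith
  by_cases hxy : x ∉ capDomain n r ∧ y ∉ capDomain n r
  · rw [hnorm, hz1 hxy.1, hz2 hxy.2, sub_zero, abs_zero, mul_zero, zero_div]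
    positivity
  have hfar : 1 ≤ ‖x - y‖ := by
    have hV' : 3 ≤ ‖x‖ ∨ 3 ≤ ‖y‖ := by
      by_contra hc
      push Not at hc
      exact hV ⟨by simpa using hc.1, by simpa using hc.2⟩
    have h1 := norm_sub_norm_le x y
    have h2 := norm_sub_norm_le y x
    rw [norm_sub_rev] at h2
    rw [not_and_or, not_not, not_not] at hxy
    rcases hxy with h | h
    · have hx := norm_lt_two_of_mem hr1 h
      rcases hV' with hV' | hV' <;> linarith
    · have hy := norm_lt_two_of_mem hr1 h
      rcases hV' with hV' | hV' <;> linarith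
  have hne : x ≠ y := by
    rintro rfl; rw [sub_self, norm_zero] at hfar; linarith
  have hfl := abs_flux_barrier_le hs0 hs1.le hp hr0.le (by linarith : r ≤ 1) hne
  have htk : tailKer (((n + 1 : ℕ) : ℝ) + s) 1 (x - y) =
      ‖x - y‖ ^ (-(((n + 1 : ℕ) : ℝ) + s)) := by
    rw [tailKer, indicator_of_mem (by exact hfar)]
  rw [← htk] at hfl
  have e : ‖weakIntegrand s p (barrier s r) φ (x, y)‖ ≤
      2 ^ (s * (p - 1)) * (‖φ x‖ * tailKer (((n + 1 : ℕ) : ℝ) + s) 1 (x - y) +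
      ‖φ y‖ * tailKer (((n + 1 : ℕ) : ℝ) + s) 1 (x - y)) := by
    rw [weakIntegrand_eq, flux_swap (barrier s r) x y, neg_mul, ← sub_eq_add_neg, ← mul_sub, norm_mul,
      Real.norm_eq_abs]
    refine (mul_le_mul hfl (norm_sub_le _ _) (norm_nonneg _) (by positivity)).trans (le_of_eq ?_)
    ring
  linarith

lemma barrier_eq_zero (hs0 : 0 < s) (hr0 : 0 ≤ r) (hr1 : r ≤ 1 / 16) {y : E} (hy : ‖y‖ ≤ 1) :
    barrier s r y = 0 := by
  have h := barrier_le (n := n) hs0 hr0 hr1 y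
  rw [extDist, max_eq_right (by linarith), Real.zero_rpow hs0.ne', mul_zero] at h
  exact le_antisymm h (barrier_nonneg hr0 y)

/-- A point at distance `d` from the unit ball sees a ball of radius `d` inside the unit ball. -/
lemma ball_subset_unit {x : E} (hx1 : 1 < ‖x‖) (hx2 : ‖x‖ ≤ 3 / 2) :
    ∃ c : E, ∀ y ∈ Metric.ball c (‖x‖ - 1), ‖y‖ ≤ 1 ∧ 0 < ‖x - y‖ ∧ ‖x - y‖ ≤ 3 * (‖x‖ - 1) := by
  have h0 : 0 < ‖x‖ := by linarith
  refine ⟨(1 - 2 * (‖x‖ - 1) / ‖x‖) • x, fun y hy => ?_⟩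
  rw [mem_ball_iff_norm] at hy
  have hc : ‖(1 - 2 * (‖x‖ - 1) / ‖x‖) • x‖ = 2 - ‖x‖ := by
    have hle : 2 * (‖x‖ - 1) / ‖x‖ ≤ 1 := by rw [div_le_one h0]; linarith
    rw [norm_smul, Real.norm_of_nonneg (by linarith)]
    field_simp; ring
  have hxc : ‖x - (1 - 2 * (‖x‖ - 1) / ‖x‖) • x‖ = 2 * (‖x‖ - 1) := by
    have : x - (1 - 2 * (‖x‖ - 1) / ‖x‖) • x = (2 * (‖x‖ - 1) / ‖x‖) • x := by
      rw [sub_smul, one_smul, sub_sub_cancel]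
    rw [this, norm_smul, Real.norm_of_nonneg (div_nonneg (by linarith) h0.le)]
    field_simp
  set c := (1 - 2 * (‖x‖ - 1) / ‖x‖) • x with hcd
  have hy1 : ‖y‖ ≤ 1 := by
    have := norm_le_norm_add_norm_sub' y c
    linarith
  refine ⟨hy1, ?_, ?_⟩
  · have := norm_sub_norm_le x y
    linarith
  · have := norm_sub_le_norm_sub_add_norm_sub x c y
    rw [norm_sub_rev c y] at this
    linarith

/-- A Hardy inequality read off from the weak integrand. If `x` is at distance `d` from the unit
ball, that ball contains a ball of radius `d` within distance `3d` of `x`, where both the barrier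
and `φ` vanish. Integrating over it alone yields at least a constant times `|φ(x)| d^(-s)`, and `d`
is at most the height. -/
lemma integrable_test_mul_height (hs0 : 0 < s) (hs1 : s < 1) (hp : 1 < p) (hr0 : 0 < r)
    (hr1 : r ≤ 1 / 16) (hφ : MemW0 s p (capDomain n r) φ) :
    Integrable fun x : E => ‖φ x‖ * height x ^ (-s) := by
  have hφi := integrable_test hp hφ
  have hF := integrable_weakIntegrand hs0 hs1 hp hr0 hr1 hφ
  set β := ((n + 1 : ℕ) : ℝ) + p * s with hβ
  have hps : 0 < p * s := by have : 0 < p := by linarith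
                             positivity
  have hβ0 : 0 < β := by positivity
  set v := (volume : Measure E).real (Metric.ball 0 1) with hv
  have hv0 : 0 < v := ENNReal.toReal_pos (Metric.measure_ball_pos _ _ one_pos).ne'
    measure_ball_lt_top.ne
  set κ := v * r ^ (s * (p - 1)) * 3 ^ (-β) with hκ
  have hκ0 : 0 < κ := by positivity
  refine (hF.norm.integral_prod_left.const_mul κ⁻¹).mono' ?_ ?_
  · have hh : Measurable (fun x : E => height x ^ (-s)) := by fun_prop
    exact hφi.norm.aestronglyMeasurable.mul hh.aestronglyMeasurable
  filter_upwards [hφ.2, hF.prod_right_ae] with x hx hFx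
  have hnn : 0 ≤ ∫ y, ‖weakIntegrand s p (barrier s r) φ (x, y)‖ :=
    integral_nonneg fun _ => norm_nonneg _
  by_cases hxU : x ∉ capDomain n r
  · rw [hx hxU]; simp only [norm_zero, zero_mul]; positivity
  rw [not_not] at hxU
  obtain ⟨hxr, hx1⟩ := mem_capDomain.1 hxU
  have hx2 : ‖x‖ ≤ 3 / 2 := by
    have h := norm_le_norm_add_norm_sub' x (pole n)
    rw [norm_pole] at h
    linarith
  obtain ⟨c, hc⟩ := ball_subset_unit hx1 hx2
  have hd0 : 0 < ‖x‖ - 1 := by linarith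
  have hdd : extDist x = ‖x‖ - 1 := max_eq_left hd0.le
  set d := ‖x‖ - 1 with hd
  have hdh : d ≤ height x := by
    have h := extDist_le_height (y := x) (by linarith)
    rwa [hdd, max_eq_left (height_pos hr1 hxr hx1).le] at h
  have hlow : ∀ᵐ y ∂(volume.restrict (Metric.ball c d)),
      (r * d) ^ (s * (p - 1)) * ‖φ x‖ * (3 * d) ^ (-β) ≤
        ‖weakIntegrand s p (barrier s r) φ (x, y)‖ := by
    filter_upwards [ae_restrict_mem measurableSet_ball, ae_restrict_of_ae hφ.2] with y hy hyφ
    obtain ⟨hy1, hy2, hy3⟩ := hc y hy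
    have hyU : y ∉ capDomain n r := fun h => by have := (mem_capDomain.1 h).2; linarith
    rw [weakIntegrand, hyφ hyU, barrier_eq_zero hs0 hr0.le hr1 hy1, sub_zero, sub_zero, norm_div,
      norm_mul, Real.norm_eq_abs (signedPow _ _), abs_signedPow hp,
      Real.norm_of_nonneg (show 0 ≤ ‖x - y‖ ^ β by positivity), div_eq_mul_inv,
      ← Real.rpow_neg hy2.le, abs_of_nonneg (barrier_nonneg hr0.le x)]
    have h1 : (r * d) ^ (s * (p - 1)) ≤ barrier s r x ^ (p - 1) := by
      rw [Real.rpow_mul (by positivity), Real.mul_rpow hr0.le hd0.le, ← hdd]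
      exact Real.rpow_le_rpow (mul_nonneg (by positivity)
        (Real.rpow_nonneg (extDist_nonneg x) _)) (le_barrier hs0 hr0.le x) (by linarith)
    have h2 : (3 * d) ^ (-β) ≤ ‖x - y‖ ^ (-β) :=
      Real.rpow_le_rpow_of_nonpos hy2 hy3 (by linarith)
    have h3 := barrier_nonneg (s := s) hr0.le x
    exact mul_le_mul (mul_le_mul_of_nonneg_right h1 (norm_nonneg _)) h2 (by positivity)
      (by positivity)
  have hint := setIntegral_mono_ae_restrict (μ := volume) (s := Metric.ball c d)
    (integrableOn_const (measure_ball_lt_top.ne)) hFx.norm.integrableOn hlow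
  have hle := setIntegral_le_integral (s := Metric.ball c d) hFx.norm
    (Filter.Eventually.of_forall fun _ => norm_nonneg _)
  have hchain := hint.trans hle
  have hvol : (volume : Measure E).real (Metric.ball c d) = d ^ (n + 1) * v := by
    rw [hv, Measure.real, Measure.real, Measure.addHaar_ball _ _ hd0.le, finrank_euclideanSpace,
      Fintype.card_fin, ENNReal.toReal_mul, ENNReal.toReal_ofReal (by positivity)]
  rw [setIntegral_const, smul_eq_mul, hvol] at hchain
  have hid : d ^ (n + 1) * v * ((r * d) ^ (s * (p - 1)) * ‖φ x‖ * (3 * d) ^ (-β)) =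
      κ * (‖φ x‖ * d ^ (-s)) := by
    have : d ^ (-s) = d ^ ((n + 1 : ℕ) : ℝ) * d ^ (s * (p - 1)) * d ^ (-β) := by
      rw [← Real.rpow_add hd0, ← Real.rpow_add hd0]; congr 1; rw [hβ]; ring
    rw [Real.mul_rpow hr0.le hd0.le, Real.mul_rpow (by norm_num) hd0.le, this, Real.rpow_natCast, hκ]
    ring
  rw [hid] at hchain
  have hds : height x ^ (-s) ≤ d ^ (-s) := Real.rpow_le_rpow_of_nonpos hd0 hdh (by linarith)
  rw [norm_mul, norm_norm, Real.norm_of_nonneg (Real.rpow_nonneg (height_pos hr1 hxr hx1).le _),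
    ← div_eq_inv_mul, le_div_iff₀ hκ0, mul_comm]
  exact (mul_le_mul_of_nonneg_left (mul_le_mul_of_nonneg_left hds (norm_nonneg _)) hκ0.le).trans
    hchain

lemma integrable_truncated (hs0 : 0 < s) (hs1 : s < 1) (hp : 1 < p) (hr0 : 0 < r)
    (hr1 : r ≤ 1 / 16) (hφ : MemW0 s p (capDomain n r) φ) {q : ℝ} (hq0 : 0 < q) (hq1 : q < 1) :
    Integrable (fun z : E × E => φ z.1 *
      (heightFar n q).indicator (fun z => flux s p (barrier s r) z.1 z.2) z)
      ((volume : Measure E).prod volume) := by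
  have hφi := integrable_test hp hφ
  have hm : AEStronglyMeasurable (fun z : E × E => φ z.1 *
      (heightFar n q).indicator (fun z => flux s p (barrier s r) z.1 z.2) z)
      ((volume : Measure E).prod volume) :=
    hφi.aestronglyMeasurable.comp_fst.mul
      ((measurable_flux hs0).indicator (measurableSet_heightFar q)).aestronglyMeasurable
  rw [integrable_prod_iff hm]
  constructor
  · filter_upwards [hφ.2] with x hx
    by_cases hxU : x ∉ capDomain n r
    · simp [hx hxU]
    obtain ⟨hxr, hx1⟩ := mem_capDomain.1 (not_not.1 hxU)
    exact (integrable_indicator_flux hs0 hs1.le hp hr0.le (by linarith) hq0 hq1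
      (height_pos hr1 hxr hx1)).const_mul (φ x)
  · refine ((integrable_test_mul_height hs0 hs1 hp hr0 hr1 hφ).const_mul
      (2 ^ (s * (p - 1)) * (((1 - q) / 2) ^ (-s) *
        ∫ z : E, tailKer (((n + 1 : ℕ) : ℝ) + s) 1 z))).mono' hm.norm.integral_prod_right' ?_
    filter_upwards [hφ.2] with x hx
    by_cases hxU : x ∉ capDomain n r
    · simp [hx hxU]
    obtain ⟨hxr, hx1⟩ := mem_capDomain.1 (not_not.1 hxU)
    have h := integral_norm_indicator_flux_le hs0 hs1.le hp hr0.le (by linarith : r ≤ 1) hq0 hq1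
      (height_pos hr1 hxr hx1)
    rw [Real.norm_of_nonneg (integral_nonneg fun _ => norm_nonneg _)]
    simp only [norm_mul (φ x), integral_const_mul]
    refine (mul_le_mul_of_nonneg_left h (norm_nonneg (φ x))).trans (le_of_eq ?_)
    ring

/-- The truncation set is symmetric and the flux antisymmetric, so the weak form is a function plus
its swap. The two halves have equal integrals, whence the factor 2. -/
lemma integral_indicator_weakIntegrand_ge (hs0 : 0 < s) (hs1 : s < 1) (hp : 1 < p) (hr0 : 0 < r)
    (hr1 : r ≤ 1 / 16) (hφ : MemW0 s p (capDomain n r) φ) (hφ0 : ∀ᵐ x, 0 ≤ φ x) {q a : ℝ}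
    (hq0 : 0 < q) (hq1 : q < 1)
    (ha : ∀ x : E, ‖x - pole n‖ < r → 1 < ‖x‖ → a ≤ ∫ y : E, (heightFar n q).indicator
      (fun z => flux s p (barrier s r) z.1 z.2) (x, y)) :
    2 * (a * ∫ x, φ x) ≤ ∫ z, (heightFar n q).indicator
      (weakIntegrand s p (barrier s r) φ) z ∂((volume : Measure E).prod volume) := by
  have hφi := integrable_test hp hφ
  have hG := integrable_truncated hs0 hs1 hp hr0 hr1 hφ hq0 hq1
  set G : E × E → ℝ := fun z => φ z.1 *
      (heightFar n q).indicator (fun z => flux s p (barrier s r) z.1 z.2) z with hGd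
  have e : ∀ z : E × E, (heightFar n q).indicator (weakIntegrand s p (barrier s r) φ) z =
      G z + G z.swap := by
    rintro ⟨x, y⟩
    simp only [hGd, Prod.swap_prod_mk]
    by_cases h : (x, y) ∈ heightFar n q
    · rw [indicator_of_mem h, indicator_of_mem h, indicator_of_mem (mem_heightFar_swap.2 h),
        weakIntegrand_eq]
      ring
    · rw [indicator_of_notMem h, indicator_of_notMem h,
        indicator_of_notMem (mt mem_heightFar_swap.1 h)]
      ring
  have hGs : Integrable (fun z : E × E => G z.swap) ((volume : Measure E).prod volume) := hG.swap
  simp only [e]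
  rw [integral_add hG hGs, integral_prod_swap, ← two_mul, integral_prod _ hG,
    ← integral_const_mul]
  refine mul_le_mul_of_nonneg_left ?_ zero_le_two
  refine integral_mono_ae (hφi.const_mul a) hG.integral_prod_left ?_
  filter_upwards [hφ.2, hφ0] with x hx hx0
  simp only [hGd, integral_const_mul]
  by_cases hxU : x ∉ capDomain n r
  · simp [hx hxU]
  obtain ⟨hxr, hx1⟩ := mem_capDomain.1 (not_not.1 hxU)
  rw [mul_comm]
  exact mul_le_mul_of_nonneg_left (ha x hxr hx1) hx0

/-- In the chart centred at `x`, points of the same height form the null set `t = 0`. Hence the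
truncations exhaust almost every pair. -/
lemma ae_height_ne :
    ∀ᵐ z : E × E ∂((volume : Measure E).prod volume), height z.1 ≠ height z.2 := by
  have hm : MeasurableSet {z : E × E | height z.1 = height z.2} :=
    measurableSet_eq_fun (by fun_prop) (by fun_prop)
  rw [ae_iff]
  simp only [ne_eq, not_not]
  rw [Measure.measure_prod_null hm]
  refine Filter.Eventually.of_forall fun x => ?_
  have hmx : MeasurableSet (Prod.mk x ⁻¹' {z : E × E | height z.1 = height z.2}) :=
    measurable_prodMk_left hm
  simp only [Pi.zero_apply]
  rw [← (measurePreserving_chart x).measure_preimage hmx.nullMeasurableSet]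
  have h := ae_snd_ne_zero (n := n)
  rw [ae_iff] at h
  refine measure_mono_null (fun w hw => ?_) h
  simp only [mem_preimage, mem_ofPred_eq, height_chart] at hw
  simp only [mem_ofPred_eq, ne_eq, not_not]
  linarith

lemma eventually_mem_heightFar {z : E × E} (hz : height z.1 ≠ height z.2) {q : ℕ → ℝ}
    (hq : Filter.Tendsto q Filter.atTop (nhds 1)) :
    ∀ᶠ k in Filter.atTop, z ∈ heightFar n (q k) := by
  rcases lt_or_gt_of_ne hz with h | h
  · have ht : Filter.Tendsto (fun k => q k * height z.2) Filter.atTop (nhds (height z.2)) := by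
      simpa using hq.mul_const (height z.2)
    filter_upwards [ht.eventually_const_lt h] with k hk using Or.inr hk.le
  · have ht : Filter.Tendsto (fun k => q k * height z.1) Filter.atTop (nhds (height z.1)) := by
      simpa using hq.mul_const (height z.1)
    filter_upwards [ht.eventually_const_lt h] with k hk using Or.inl hk.le

lemma weaklyGe_barrier (hs0 : 0 < s) (hs1 : s < 1) (hp : 1 < p) (hr0 : 0 < r)
    (hr1 : r ≤ 1 / 16) {a : ℝ}
    (ha : ∀ x : E, ‖x - pole n‖ < r → 1 < ‖x‖ → ∀ q : ℝ, 1 / 2 ≤ q → q < 1 →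
      a ≤ ∫ y : E, (heightFar n q).indicator
        (fun z => flux s p (barrier s r) z.1 z.2) (x, y)) {a' : ℝ} (ha' : a' ≤ 2 * a) :
    WeaklyGe s p (capDomain n r) (barrier s r) a' := by
  refine ⟨memWTilde_barrier hs0 hs1 hp hr0 hr1, fun φ hφ hφ0 => ?_⟩
  have hF := integrable_weakIntegrand hs0 hs1 hp hr0 hr1 hφ
  refine ⟨hF, ?_⟩
  have hφU : ∫ x in capDomain n r, φ x = ∫ x, φ x :=
    setIntegral_eq_integral_of_ae_compl_eq_zero hφ.2
  have hI0 : 0 ≤ ∫ x, φ x := integral_nonneg_of_ae hφ0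
  rw [hφU]
  have h1 : a' * ∫ x, φ x ≤ 2 * (a * ∫ x, φ x) := by nlinarith
  refine h1.trans ?_
  -- Any sequence in `[1/2, 1)` tending to 1 would do; the bound `a` is uniform along it.
  set q : ℕ → ℝ := fun k => 1 - 1 / 2 * (1 / ((k : ℝ) + 1)) with hq
  have hqt : Filter.Tendsto q Filter.atTop (nhds 1) := by
    have := (tendsto_one_div_add_atTop_nhds_zero_nat (𝕜 := ℝ)).const_mul (1 / 2)
    simpa [hq] using this.const_sub 1
  have hqb : ∀ k, 1 / 2 ≤ q k ∧ q k < 1 := by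
    intro k
    have h0 : (0 : ℝ) < 1 / ((k : ℝ) + 1) := by positivity
    have h2 : 1 / ((k : ℝ) + 1) ≤ 1 := by
      rw [div_le_one (by positivity)]; have : (0 : ℝ) ≤ k := Nat.cast_nonneg k
      linarith
    simp only [hq]
    constructor <;> linarith
  have hlim : Filter.Tendsto (fun k => ∫ z, (heightFar n (q k)).indicator
      (weakIntegrand s p (barrier s r) φ) z ∂((volume : Measure E).prod volume)) Filter.atTop
      (nhds (∫ z, weakIntegrand s p (barrier s r) φ z ∂((volume : Measure E).prod volume))) := by
    refine tendsto_integral_of_dominated_convergence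
      (fun z => ‖weakIntegrand s p (barrier s r) φ z‖)
      (fun k => hF.aestronglyMeasurable.indicator (measurableSet_heightFar _)) hF.norm
      (fun k => Filter.Eventually.of_forall fun z => norm_indicator_le_norm_self _ _) ?_
    filter_upwards [ae_height_ne] with z hz
    refine tendsto_const_nhds.congr' ?_
    filter_upwards [eventually_mem_heightFar hz hqt] with k hk
    rw [indicator_of_mem hk]
  refine ge_of_tendsto hlim (Filter.Eventually.of_forall fun k => ?_)
  exact integral_indicator_weakIntegrand_ge hs0 hs1 hp hr0 hr1 hφ hφ0
    (by linarith [(hqb k).1]) (hqb k).2 fun x hx hx1 => ha x hx hx1 (q k) (hqb k).1 (hqb k).2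

end Weak

end FracPLap

/-! ### Conclusion. -/

theorem lemma4p2 (N : ℕ) (hN : 1 < N) (s p : ℝ) (hs0 : 0 < s) (hs1 : s < 1) (hp : 1 < p) :
    ∃ (w : EuclideanSpace ℝ (Fin N) → ℝ) (r a c : ℝ),
      (∃ C : ℝ≥0, HolderWith C s.toNNReal w) ∧
      0 < r ∧ (0 < a ∧ a < 1) ∧ 1 < c ∧
      FracPLap.WeaklyGe s p
        (Metric.ball (EuclideanSpace.single (⟨N - 1, by omega⟩ : Fin N) (1 : ℝ)) r \
          Metric.closedBall 0 1) w a ∧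
      ∀ x : EuclideanSpace ℝ (Fin N),
        c⁻¹ * (max (‖x‖ - 1) 0) ^ s ≤ w x ∧ w x ≤ c * (max (‖x‖ - 1) 0) ^ s := by
  obtain ⟨n, rfl⟩ : ∃ n, N = n + 1 := ⟨N - 1, by omega⟩
  obtain ⟨r, a, hr0, hr1, ha0, ha⟩ :=
    FracPLap.exists_integral_flux_ge (n := n) (p := p) (by omega) hs0 hs1 hp
  have h2s : (0 : ℝ) < 2 ^ s := by positivity
  have hrs : 0 < r ^ s := by positivity
  -- The minimum keeps the constant below 1. The last witness dominates 1, the upper constant `2^s`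
  -- and the inverse of the lower constant `r^s`.
  refine ⟨FracPLap.barrier s r, r, min (1 / 2) a, 1 + 2 ^ s + (r ^ s)⁻¹,
    FracPLap.exists_holderWith_barrier hs0 hs1.le hr0.le (by linarith), hr0,
    ⟨by positivity, (min_le_left _ _).trans_lt (by norm_num)⟩, ?_, ?_, fun x => ⟨?_, ?_⟩⟩
  · have := inv_pos.2 hrs
    linarith
  · exact FracPLap.weaklyGe_barrier hs0 hs1 hp hr0 hr1 ha
      ((min_le_right _ _).trans (by linarith))
  · refine le_trans ?_ (FracPLap.le_barrier hs0 hr0.le x)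
    refine mul_le_mul_of_nonneg_right ?_ (Real.rpow_nonneg (le_max_right _ _) s)
    exact inv_le_of_inv_le₀ hrs (by linarith)
  · refine (FracPLap.barrier_le hs0 hr0.le hr1 x).trans ?_
    refine mul_le_mul_of_nonneg_right ?_ (Real.rpow_nonneg (le_max_right _ _) s)
    have := inv_pos.2 hrs
    linarith
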